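/- Let $p>2$, $\omega>0$. Let $\varphi$ be a bell-shaped (even, nonnegative, nonincreasing on $(0,\infty)$) minimizer, taken in its continuous representative, of $$N_0[v]=\tfrac14\int_{\mathbb R}|v'|^2\,dx+\omega\int_{\mathbb R}|v|\,dx\quad\text{subject to}\quad\int_{\mathbb R}|v|^{p/2}\,dx=1,$$ over real $v\in H^1(\mathbb R)\cap L^1(\mathbb R)$, and let $\Phi=\sqrt{\varphi}$. Then $\Phi$ is bell-shaped and minimizes $$N[u]=\int_{\mathbb R}|u\,\partial_xu|^2\,dx+\omega\int_{\mathbb R}|u|^2\,dx\quad\text{subject to}\quad\int_{\mathbb R}|u|^p\,dx=1$$ over real $u\in L^2(\mathbb R)$ with $u^2\in H^1(\mathbb R)$, where $u\,\partial_xu:=\tfrac12\partial_x(u^2)$. There is $L>0$ with $\{\Phi\neq0\}=(-L,L)$, $\Phi$ is $C^2$ on $(-L,L)$, and it satisfies the Euler–Lagrange equation $$-\Phi\,\partial_x(\Phi\Phi')+\omega\Phi-c(\omega)\Phi^{p-1}=0,\qquad -L<x<L,$$ with $c(\omega)=2\int_{\mathbb R}(\Phi\Phi')^2\,dx+\omega\int_{\mathbb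 R}\Phi^2\,dx$. In addition, consider in the Hilbert space $L^2(\mathbb R;\mathbb C)$ the operator $$\mathcal L_+f=-\Phi\,\partial_x^2(\Phi f)+\omega f-(\Phi\Phi')'f-(p-1)\,c(\omega)\,\Phi^{p-2}f,$$ where the derivatives are taken pointwise, away from $x=\pm L$. It maps $C_c^\infty(\mathbb R;\mathbb C)$ into $L^2(\mathbb R;\mathbb C)$ and is symmetric there. Every self-adjoint operator $T$ in $L^2(\mathbb R;\mathbb C)$ that extends $\mathcal L_+$ acting on $C_c^\infty(\mathbb R\setminus\{-L,L\};\mathbb C)$ (in particular, every self-adjoint extension of $\mathcal L_+$ acting on $C_c^\infty(\mathbb R;\mathbb C)$) satisfies $\langle Tu,u\rangle\ge0$ for all $u$ in the domain of $T$ with $\int_{\mathbb R}\Phi^{p-1}u\,dx=0$. In particular, $T$ has at most one negative eigenvalue, counted with multiplicity. -/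

import Mathlib

open MeasureTheory Set Filter Topology
open scoped ENNReal

noncomputable section

namespace Compacton

/-- Bell-shaped functions: even, nonnegative, and nonincreasing on `(0, ∞)`. -/
structure BellShaped (f : ℝ → ℝ) : Prop where
  even : ∀ x, f (-x) = f x
  nonneg : ∀ x, 0 ≤ f x
  anti : AntitoneOn f (Ioi 0)

/-- `g` is the weak derivative of `v` on the real line. -/
structure IsWeakDeriv (v g : ℝ → ℝ) : Prop where
  locInt : LocallyIntegrable v
  locInt_deriv : LocallyIntegrable g
  integral_eq : ∀ η : ℝ → ℝ, ContDiff ℝ (⊤ : ℕ∞) η → HasCompactSupport η →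
    ∫ x, v x * deriv η x = - ∫ x, g x * η x

/-- Admissible functions of the problem for `v`: `v ∈ H¹(ℝ) ∩ L¹(ℝ)`, with weak derivative `g`,
and `∫ |v| ^ (p / 2) = 1`. -/
structure AdmissibleV (p : ℝ) (v g : ℝ → ℝ) : Prop where
  integrable : Integrable v
  memL2 : MemLp v 2
  memL2_deriv : MemLp g 2
  weakDeriv : IsWeakDeriv v g
  constraint : ∫ x, |v x| ^ (p / 2) = 1

/-- `N₀[v] = (1/4) ∫ |v'|² + ω ∫ |v|`, where `g = v'`. -/
def energyV (ω : ℝ) (v g : ℝ → ℝ) : ℝ :=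
  (1 / 4) * (∫ x, (g x) ^ 2) + ω * ∫ x, |v x|

/-- `v` minimizes `N₀` subject to `∫ |v| ^ (p / 2) = 1`. -/
def IsMinimizerV (p ω : ℝ) (v : ℝ → ℝ) : Prop :=
  ∃ g, AdmissibleV p v g ∧ ∀ w k, AdmissibleV p w k → energyV ω v g ≤ energyV ω w k

/-- Admissible functions of the problem for `u`: `u ∈ L²(ℝ)`, `u² ∈ H¹(ℝ)`, `∫ |u| ^ p = 1`;
here `g` stands for `u ∂ₓu`, that is, for the weak derivative of `u² / 2`. -/
structure AdmissibleU (p : ℝ) (u g : ℝ → ℝ) : Prop where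
  memL2 : MemLp u 2
  memL2_sq : MemLp (fun x => (u x) ^ 2) 2
  memL2_deriv : MemLp g 2
  weakDeriv : IsWeakDeriv (fun x => (u x) ^ 2 / 2) g
  constraint : ∫ x, |u x| ^ p = 1

/-- `N[u] = ∫ |u ∂ₓu|² + ω ∫ |u|²`, where `g = u ∂ₓu`. -/
def energyU (ω : ℝ) (u g : ℝ → ℝ) : ℝ :=
  (∫ x, (g x) ^ 2) + ω * ∫ x, |u x| ^ 2

/-- `u` minimizes `N` subject to `∫ |u| ^ p = 1`. -/
def IsMinimizerU (p ω : ℝ) (u : ℝ → ℝ) : Prop :=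
  ∃ g, AdmissibleU p u g ∧ ∀ w k, AdmissibleU p w k → energyU ω u g ≤ energyU ω w k

/-- The Lagrange multiplier `c(ω) = 2 ∫ (Φ Φ')² + ω ∫ Φ²`. -/
def multiplier (ω : ℝ) (Φ : ℝ → ℝ) : ℝ :=
  2 * (∫ x, (Φ x * deriv Φ x) ^ 2) + ω * ∫ x, (Φ x) ^ 2

/-- The differential expression
`𝓛₊ f = -Φ ∂ₓ²(Φ f) + ω f - (Φ Φ')' f - (p - 1) c(ω) Φ ^ (p - 2) f`. -/
def Lplus (p ω : ℝ) (Φ : ℝ → ℝ) (f : ℝ → ℂ) (x : ℝ) : ℂ :=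
  -(Φ x : ℂ) * deriv (deriv fun y => (Φ y : ℂ) * f y) x + (ω : ℂ) * f x
    - ((deriv (fun y => Φ y * deriv Φ y) x : ℝ) : ℂ) * f x
    - (((p - 1) * multiplier ω Φ * Φ x ^ (p - 2) : ℝ) : ℂ) * f x

/-- `C_c^∞(ℝ; ℂ)`. -/
def IsTest (f : ℝ → ℂ) : Prop :=
  ContDiff ℝ (⊤ : ℕ∞) f ∧ HasCompactSupport f

/-- The Hilbert space `L²(ℝ; ℂ)`. -/
abbrev L2 : Type := Lp ℂ 2 (volume : Measure ℝ)

/-- The operator `T` in `L²(ℝ; ℂ)` extends `𝓛₊` acting on the test functions that vanish near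
`±L`. This is the smallest natural domain, so the condition holds in particular for every
extension of `𝓛₊` acting on any larger space of functions, such as all of `C_c^∞(ℝ; ℂ)`. -/
def ExtendsLplus (p ω L : ℝ) (Φ : ℝ → ℝ) (T : L2 →ₗ.[ℂ] L2) : Prop :=
  ∀ f : ℝ → ℂ, IsTest f → L ∉ tsupport f → -L ∉ tsupport f →
    ∃ u : T.domain, ((u : L2) : ℝ → ℂ) =ᵐ[volume] f ∧
      ((T u : L2) : ℝ → ℂ) =ᵐ[volume] Lplus p ω Φ f

end Compacton

end

/-!
The problem for `u` becomes the one for `v` under `v = u²`, so that `Φ = √φ` is a minimizer, and all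
of the analysis takes place for `φ`.

*The equation for `φ`.* Comparing `φ` with rescaled perturbations `φ + ε η` that stay nonnegative
gives `c ∫ φ ^ (p/2 - 1) η ≤ (1/2) ∫ φ' η' + ω ∫ η`
(`Compacton.BellMinimizer.first_variation_le`), with equality when `η` is supported where `φ > 0`.
There `φ'' = 2 (ω - c φ ^ (p/2 - 1))`. Far away `φ` is small, so `φ'' ≈ 2ω > 0` would contradict its
decay: the support of `φ` is bounded. The one-sided inequality at the edge excludes a corner
(`Compacton.BellMinimizer.phiDeriv_edge`), hence the energy identity
`φ'² = 4ωφ - (8c/p) φ ^ (p/2)` holds, and `Φ' = φ' / (2Φ)` is bounded. With these two identities all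
derivatives of `Φ` disappear from `𝓛₊`: inside the support
`𝓛₊ f = -(φ f')' + c (3 - 2/p - p) φ ^ (p/2 - 1) f`, and outside `𝓛₊ f = ω f`. This has bounded
coefficients, and it is symmetric because `φ` vanishes at the edge.

*Self-adjoint extensions.* If `T` is a self-adjoint extension and `u` lies in its domain, testing
against `ψ / Φ` shows that `(Φ u)'' = -(T u + V u) / Φ` weakly in the interior, with
`V = (p - 2) c Φ ^ (p - 2)`; by the du Bois-Reymond lemma `Φ u` is of class `C¹` there. For a cutoff
`χ`, integration by parts gives
`∫ (T u) u χ² = ∫ ((Φ u χ)')² - ∫ V u² χ² - ∫ (Φ u χ')²`.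
The first two terms form twice the second variation of the energy in the direction `Φ u χ`, which is
nonnegative up to multiples of `∫ φ ^ (p/2 - 1) Φ u χ` (`Compacton.BellMinimizer.second_variation`);
the constraint integral of `φ + ε ψ` is only bounded from below, by Bernoulli-type inequalities, and
never differentiated. Since `|Φ'|` is bounded, a cutoff depending on `log φ / n` satisfies
`|Φ χ'| = O(1/n)`: the edge is so degenerate that no boundary condition can be imposed at it, and
the limit `n → ∞` yields `⟨T u, u⟩ ≥ 0` when `u` is orthogonal to `Φ ^ (p - 1)`. Nonnegativity on the
complement of a single vector leaves room for only one negative eigenvalue.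
-/

namespace Compacton

/-! ### Weak solutions of `f'' = h` on an interval -/

theorem one_le_infty : (1 : WithTop ℕ∞) ≤ ((⊤ : ℕ∞) : WithTop ℕ∞) := by exact_mod_cast le_top

theorem exists_Icc_of_tsupport_subset {E : Type*} [Zero E] {ψ : ℝ → E} {a b x₀ : ℝ}
    (hc : HasCompactSupport ψ)
    (hs : tsupport ψ ⊆ Ioo a b) (hx₀ : x₀ ∈ Ioo a b) :
    ∃ a' b', a < a' ∧ b' < b ∧ x₀ ∈ Ioo a' b' ∧ tsupport ψ ⊆ Ioo a' b' := by
  have hK : IsCompact (insert x₀ (tsupport ψ)) := hc.isCompact.insert x₀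
  have hne : (insert x₀ (tsupport ψ)).Nonempty := ⟨x₀, mem_insert _ _⟩
  have hsub : insert x₀ (tsupport ψ) ⊆ Ioo a b := insert_subset hx₀ hs
  obtain ⟨m, hm, hm'⟩ := hK.exists_isLeast hne
  obtain ⟨M, hM, hM'⟩ := hK.exists_isGreatest hne
  have h1 := hsub hm
  have h2 := hsub hM
  have key : ∀ y ∈ insert x₀ (tsupport ψ), y ∈ Ioo ((a + m) / 2) ((M + b) / 2) := fun y hy =>
    ⟨by linarith [hm' hy, h1.1], by linarith [hM' hy, h2.2]⟩
  exact ⟨(a + m) / 2, (M + b) / 2, by linarith [h1.1], by linarith [h2.2],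
    key _ (mem_insert _ _), fun y hy => key y (mem_insert_of_mem _ hy)⟩

theorem integral_eq_intervalIntegral_of_tsupport_subset {E : Type*} [NormedAddCommGroup E]
    [NormedSpace ℝ E] {f : ℝ → E} {F : Type*} [Zero F] {ψ : ℝ → F} {a b : ℝ}
    (hs : tsupport ψ ⊆ Ioo a b) (h0 : ∀ x ∉ tsupport ψ, f x = 0) :
    ∫ x, f x = ∫ x in a..b, f x := by
  refine (intervalIntegral.integral_eq_integral_of_support_subset fun x hx => ?_).symm
  have : x ∈ tsupport ψ := by
    by_contra h
    exact hx (h0 x h)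
  exact Ioo_subset_Ioc_self (hs this)

theorem deriv_eq_zero_of_notMem_tsupport {E : Type*} [NormedAddCommGroup E] [NormedSpace ℝ E]
    {ψ : ℝ → E} {x : ℝ} (hx : x ∉ tsupport ψ) : deriv ψ x = 0 := by
  by_contra h
  exact hx (support_deriv_subset h)

theorem contDiff_of_contDiffAt_tsupport {E : Type*} [NormedAddCommGroup E] [NormedSpace ℝ E]
    {n : WithTop ℕ∞} {f : ℝ → E} (h : ∀ x ∈ tsupport f, ContDiffAt ℝ n f x) : ContDiff ℝ n f := by
  refine contDiff_iff_contDiffAt.2 fun x => ?_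
  by_cases hx : x ∈ tsupport f
  · exact h x hx
  · exact contDiffAt_const.congr_of_eventuallyEq (notMem_tsupport_iff_eventuallyEq.1 hx)

theorem intervalIntegrable_of_locallyIntegrableOn_Ioo {h : ℝ → ℝ} {a b a' b' : ℝ}
    (hh : LocallyIntegrableOn h (Ioo a b)) (ha : a' ∈ Ioo a b) (hb : b' ∈ Ioo a b) :
    IntervalIntegrable h volume a' b' := by
  rw [intervalIntegrable_iff]
  refine IntegrableOn.mono_set ?_ uIoc_subset_uIcc
  exact hh.integrableOn_compact_subset (ordConnected_Ioo.uIcc_subset ha hb) isCompact_uIcc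

/-- Integration by parts against a primitive of a locally integrable function. -/
theorem integral_mul_eq_neg_integral_primitive_mul_deriv {h ψ : ℝ → ℝ} {a b x₀ : ℝ}
    (hh : LocallyIntegrableOn h (Ioo a b)) (hx₀ : x₀ ∈ Ioo a b)
    (hψ : ContDiff ℝ 1 ψ) (hc : HasCompactSupport ψ) (hs : tsupport ψ ⊆ Ioo a b) (d : ℝ) :
    ∫ x, h x * ψ x = -∫ x, (d + ∫ t in x₀..x, h t) * deriv ψ x := by
  obtain ⟨a', b', ha, hb, hx, hs'⟩ := exists_Icc_of_tsupport_subset hc hs hx₀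
  have hab : a' ≤ b' := (hx.1.trans hx.2).le
  have hI : IntervalIntegrable h volume a' b' :=
    intervalIntegrable_of_locallyIntegrableOn_Ioo hh ⟨ha, by linarith [hx.1, hx.2]⟩
      ⟨by linarith [hx.1, hx.2], hb⟩
  have hxu : x₀ ∈ uIcc a' b' := by rw [uIcc_of_le hab]; exact Ioo_subset_Icc_self hx
  have hF := hI.absolutelyContinuousOnInterval_intervalIntegral hxu
  have hψa : ψ a' = 0 := image_eq_zero_of_notMem_tsupport fun h => lt_irrefl _ (hs' h).1
  have hψb : ψ b' = 0 := image_eq_zero_of_notMem_tsupport fun h => lt_irrefl _ (hs' h).2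
  have hF' : AbsolutelyContinuousOnInterval (fun x => d + ∫ t in x₀..x, h t) a' b' :=
    AbsolutelyContinuousOnInterval.add
      (ContDiffOn.absolutelyContinuousOnInterval contDiffOn_const) hF
  have hψac : AbsolutelyContinuousOnInterval ψ a' b' :=
    ContDiffOn.absolutelyContinuousOnInterval hψ.contDiffOn
  rw [integral_eq_intervalIntegral_of_tsupport_subset hs' (f := fun x => h x * ψ x)
      (fun x hx => by simp [image_eq_zero_of_notMem_tsupport hx]),
    integral_eq_intervalIntegral_of_tsupport_subset hs' (f := fun x => _ * deriv ψ x)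
      (fun x hx => by simp [deriv_eq_zero_of_notMem_tsupport hx]),
    hF'.integral_mul_deriv_eq_deriv_mul hψac, hψa, hψb]
  simp only [mul_zero, sub_zero, zero_sub, neg_neg]
  refine intervalIntegral.integral_congr_ae ?_
  filter_upwards [hI.ae_hasDerivAt_integral] with x hx hxm
  rw [((hx (uIoc_subset_uIcc hxm) x₀ hxu).const_add d).deriv]

/-- Integration by parts for a classical derivative given only on the interval, against a function
supported there. -/
theorem integral_deriv_mul_eq_neg {F D ψ : ℝ → ℝ} {a b : ℝ}
    (hF : ∀ x ∈ Ioo a b, HasDerivAt F (D x) x) (hD : ContinuousOn D (Ioo a b))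
    (hψ : ContDiff ℝ 1 ψ) (hc : HasCompactSupport ψ) (hs : tsupport ψ ⊆ Ioo a b) :
    ∫ x, D x * ψ x = -∫ x, F x * deriv ψ x := by
  rcases (tsupport ψ).eq_empty_or_nonempty with he | ⟨x₀, hx⟩
  · have : ψ = 0 := tsupport_eq_empty_iff.1 he
    simp [this]
  have hx₀ := hs hx
  rw [integral_mul_eq_neg_integral_primitive_mul_deriv
    (hD.locallyIntegrableOn measurableSet_Ioo) hx₀ hψ hc hs (F x₀)]
  congr 1
  refine integral_congr_ae (Eventually.of_forall fun x => ?_)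
  by_cases hxs : x ∈ tsupport ψ
  · have hsub : uIcc x₀ x ⊆ Ioo a b := ordConnected_Ioo.uIcc_subset hx₀ (hs hxs)
    have := intervalIntegral.integral_eq_sub_of_hasDerivAt (a := x₀) (b := x)
      (fun y hy => hF y (hsub hy)) ((hD.mono hsub).intervalIntegrable)
    simp [this]
  · simp [deriv_eq_zero_of_notMem_tsupport hxs]

theorem exists_smooth_primitive {η : ℝ → ℝ} {a b : ℝ} (hη : ContDiff ℝ (⊤ : ℕ∞) η)
    (hc : HasCompactSupport η) (hs : tsupport η ⊆ Ioo a b) (h0 : ∫ x, η x = 0) :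
    ∃ ψ : ℝ → ℝ, ContDiff ℝ (⊤ : ℕ∞) ψ ∧ HasCompactSupport ψ ∧ tsupport ψ ⊆ Ioo a b ∧
      deriv ψ = η := by
  rcases (tsupport η).eq_empty_or_nonempty with he | ⟨x₀, hx⟩
  · refine ⟨0, contDiff_const, HasCompactSupport.zero, by simp [tsupport], ?_⟩
    rw [tsupport_eq_empty_iff.1 he]
    ext x
    simp
  obtain ⟨a', b', ha, hb, hx', hs'⟩ := exists_Icc_of_tsupport_subset hc hs (hs hx)
  have hder : ∀ x, HasDerivAt (fun x => ∫ t in a'..x, η t) (η x) x := fun x =>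
    intervalIntegral.integral_hasDerivAt_right (hη.continuous.intervalIntegrable _ _)
      (hη.continuous.stronglyMeasurableAtFilter _ _) hη.continuous.continuousAt
  have hd : deriv (fun x => ∫ t in a'..x, η t) = η := funext fun x => (hder x).deriv
  have hη0 : ∀ x, x ∉ Ioo a' b' → η x = 0 := fun x hx =>
    image_eq_zero_of_notMem_tsupport fun h => hx (hs' h)
  have hsupp : Function.support (fun x => ∫ t in a'..x, η t) ⊆ Icc a' b' := by
    intro x hx
    by_contra hn
    refine hx ?_
    rcases lt_or_ge x a' with h | h
    · beta_reduce
      rw [intervalIntegral.integral_zero_ae]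
      refine Eventually.of_forall fun t ht => hη0 t fun h' => ?_
      rw [uIoc_of_ge h.le] at ht
      exact absurd h'.1 (not_lt.2 ht.2)
    · have hbx : b' < x := by
        by_contra h'
        exact hn ⟨h, not_lt.1 h'⟩
      beta_reduce
      rw [← h0]
      refine intervalIntegral.integral_eq_integral_of_support_subset fun t ht => ?_
      have : t ∈ Ioo a' b' := by
        by_contra h'
        exact ht (hη0 t h')
      exact ⟨this.1, this.2.le.trans hbx.le⟩
  have htsupp : tsupport (fun x => ∫ t in a'..x, η t) ⊆ Icc a' b' :=
    closure_minimal hsupp isClosed_Icc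
  refine ⟨_, ?_, HasCompactSupport.of_support_subset_isCompact isCompact_Icc hsupp,
    htsupp.trans (Icc_subset_Ioo ha hb), hd⟩
  rw [contDiff_infty_iff_deriv, hd]
  exact ⟨fun x => (hder x).differentiableAt, hη⟩

theorem exists_bump_integral_eq_one {a b : ℝ} (hab : a < b) :
    ∃ η : ℝ → ℝ, ContDiff ℝ (⊤ : ℕ∞) η ∧ HasCompactSupport η ∧ tsupport η ⊆ Ioo a b ∧
      ∫ x, η x = 1 := by
  let f : ContDiffBump ((a + b) / 2) := ⟨(b - a) / 8, (b - a) / 4, by linarith, by linarith⟩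
  refine ⟨f.normed volume, f.contDiff_normed, f.hasCompactSupport_normed, ?_,
    f.integral_normed⟩
  rw [f.tsupport_normed_eq, Real.closedBall_eq_Icc]
  refine Icc_subset_Ioo ?_ ?_ <;> simp only [f] <;> linarith

/-- Any test function is a derivative of a test function up to a multiple of a fixed bump. -/
theorem exists_primitive_sub_mul_bump {η η₀ : ℝ → ℝ} {a b : ℝ} (hη : ContDiff ℝ (⊤ : ℕ∞) η)
    (hc : HasCompactSupport η) (hs : tsupport η ⊆ Ioo a b) (hη₀ : ContDiff ℝ (⊤ : ℕ∞) η₀)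
    (hc₀ : HasCompactSupport η₀) (hs₀ : tsupport η₀ ⊆ Ioo a b) (h1 : ∫ x, η₀ x = 1) :
    ∃ ψ : ℝ → ℝ, ContDiff ℝ (⊤ : ℕ∞) ψ ∧ HasCompactSupport ψ ∧ tsupport ψ ⊆ Ioo a b ∧
      deriv ψ = fun x => η x - (∫ t, η t) * η₀ x := by
  have hi := hη.continuous.integrable_of_hasCompactSupport (μ := volume) hc
  have hi0 := hη₀.continuous.integrable_of_hasCompactSupport (μ := volume) hc₀
  have hsub : tsupport (fun x => η x - (∫ t, η t) * η₀ x) ⊆ tsupport η ∪ tsupport η₀ := by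
    refine closure_minimal (fun x hx => ?_) ((isClosed_tsupport _).union (isClosed_tsupport _))
    by_contra hn
    rw [mem_union, not_or] at hn
    exact hx (by simp [image_eq_zero_of_notMem_tsupport hn.1,
      image_eq_zero_of_notMem_tsupport hn.2])
  exact exists_smooth_primitive (hη.sub (contDiff_const.mul hη₀))
    ((hc.isCompact.union hc₀.isCompact).of_isClosed_subset (isClosed_tsupport _) hsub)
    (hsub.trans (union_subset hs hs₀))
    (by rw [integral_sub hi (hi0.const_mul _), integral_const_mul, h1]; ring)

theorem integrable_mul_of_locallyIntegrableOn {f η : ℝ → ℝ} {a b : ℝ}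
    (hf : LocallyIntegrableOn f (Ioo a b)) (hη : Continuous η) (hc : HasCompactSupport η)
    (hs : tsupport η ⊆ Ioo a b) : Integrable fun x => f x * η x := by
  have h1 : IntegrableOn (fun x => f x * η x) (tsupport η) :=
    (hf.integrableOn_compact_subset hs hc.isCompact).mul_continuousOn hη.continuousOn hc.isCompact
  refine (integrableOn_iff_integrable_of_support_subset fun x hx => ?_).1 h1
  by_contra h
  exact hx (by simp [image_eq_zero_of_notMem_tsupport h])

/-- The lemma of du Bois-Reymond: a function with vanishing weak derivative on an interval is
constant there. -/
theorem ae_eq_const_of_integral_mul_deriv_eq_zero {f : ℝ → ℝ} {a b : ℝ} (hab : a < b)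
    (hf : LocallyIntegrableOn f (Ioo a b))
    (h : ∀ η : ℝ → ℝ, ContDiff ℝ (⊤ : ℕ∞) η → HasCompactSupport η → tsupport η ⊆ Ioo a b →
      ∫ x, f x * deriv η x = 0) :
    ∃ C, ∀ᵐ x, x ∈ Ioo a b → f x = C := by
  obtain ⟨η₀, h1, h2, h3, h4⟩ := exists_bump_integral_eq_one hab
  refine ⟨∫ x, f x * η₀ x, ?_⟩
  have key := isOpen_Ioo.ae_eq_zero_of_integral_contDiff_smul_eq_zero (μ := volume)
    (f := fun x => f x - ∫ x, f x * η₀ x) (U := Ioo a b)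
    (hf.sub (continuousOn_const.locallyIntegrableOn measurableSet_Ioo)) ?_
  · filter_upwards [key] with x hx hxm
    exact sub_eq_zero.1 (hx hxm)
  intro η e1 e2 e3
  have hi := e1.continuous.integrable_of_hasCompactSupport (μ := volume) e2
  obtain ⟨ψ, p1, p2, p3, p4⟩ := exists_primitive_sub_mul_bump e1 e2 e3 h1 h2 h3 h4
  set I := ∫ x, η x with hI
  have := h ψ p1 p2 p3
  rw [p4] at this
  have j1 := integrable_mul_of_locallyIntegrableOn hf e1.continuous e2 e3
  have j2 := integrable_mul_of_locallyIntegrableOn hf h1.continuous h2 h3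
  have e : ∀ x, f x * (η x - I * η₀ x) = f x * η x - I * (f x * η₀ x) := fun x => by ring
  simp_rw [e] at this
  rw [integral_sub j1 (j2.const_mul _), integral_const_mul] at this
  simp only [smul_eq_mul, mul_sub]
  have e' : ∀ x, η x * f x = f x * η x := fun x => mul_comm _ _
  simp_rw [e']
  rw [integral_sub j1 (hi.mul_const _), integral_mul_const, ← hI]
  linarith

theorem tsupport_deriv_subset_of_subset {ψ : ℝ → ℝ} {s : Set ℝ} (h : tsupport ψ ⊆ s) :
    tsupport (deriv ψ) ⊆ s :=
  (closure_minimal support_deriv_subset (isClosed_tsupport _)).trans h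

/-- A weak solution of `f'' = h` on an interval has a representative which is continuously
differentiable, and whose derivative is a primitive of `h`. -/
theorem exists_primitive_of_weak_second_deriv {f h : ℝ → ℝ} {a b x₀ : ℝ} (hx₀ : x₀ ∈ Ioo a b)
    (hf : LocallyIntegrableOn f (Ioo a b)) (hh : LocallyIntegrableOn h (Ioo a b))
    (H : ∀ η : ℝ → ℝ, ContDiff ℝ (⊤ : ℕ∞) η → HasCompactSupport η → tsupport η ⊆ Ioo a b →
      ∫ x, f x * deriv (deriv η) x = ∫ x, h x * η x) :
    ∃ (F : ℝ → ℝ) (d : ℝ), (∀ᵐ x, x ∈ Ioo a b → f x = F x) ∧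
      ContinuousOn (fun x => d + ∫ t in x₀..x, h t) (Ioo a b) ∧
      ∀ x ∈ Ioo a b, HasDerivAt F (d + ∫ t in x₀..x, h t) x := by
  have hab : a < b := hx₀.1.trans hx₀.2
  -- `D` and `K` are the first and second primitives of `h`
  set D : ℝ → ℝ := fun x => ∫ t in x₀..x, h t with hD
  have hDc : ContinuousOn D (Ioo a b) := by
    intro x hx
    have h1 : a < min ((a + x) / 2) ((a + x₀) / 2) :=
      lt_min (by linarith [hx.1]) (by linarith [hx₀.1])
    have h2 : max ((b + x) / 2) ((b + x₀) / 2) < b :=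
      max_lt (by linarith [hx.2]) (by linarith [hx₀.2])
    have hx1 : min ((a + x) / 2) ((a + x₀) / 2) < x :=
      (min_le_left _ _).trans_lt (by linarith [hx.1])
    have hx2 : x < max ((b + x) / 2) ((b + x₀) / 2) :=
      lt_of_lt_of_le (by linarith [hx.2]) (le_max_left _ _)
    have hx3 : min ((a + x) / 2) ((a + x₀) / 2) < x₀ :=
      (min_le_right _ _).trans_lt (by linarith [hx₀.1])
    have hx4 : x₀ < max ((b + x) / 2) ((b + x₀) / 2) :=
      lt_of_lt_of_le (by linarith [hx₀.2]) (le_max_right _ _)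
    have hI := intervalIntegrable_of_locallyIntegrableOn_Ioo hh
      ⟨h1, hx1.trans hx.2⟩ ⟨hx.1.trans hx2, h2⟩
    have := (hI.absolutelyContinuousOnInterval_intervalIntegral (c := x₀) (by
      rw [uIcc_of_le (hx1.trans hx2).le]; exact ⟨hx3.le, hx4.le⟩)).continuousOn
    rw [uIcc_of_le (hx1.trans hx2).le] at this
    exact (this.continuousAt (Icc_mem_nhds hx1 hx2)).continuousWithinAt
  have hDl : LocallyIntegrableOn D (Ioo a b) := hDc.locallyIntegrableOn measurableSet_Ioo
  have hKd : ∀ x ∈ Ioo a b, HasDerivAt (fun x => ∫ t in x₀..x, D t) (D x) x := fun x hx =>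
    intervalIntegral.integral_hasDerivAt_right
      (intervalIntegrable_of_locallyIntegrableOn_Ioo hDl hx₀ hx)
      (hDc.stronglyMeasurableAtFilter isOpen_Ioo x hx) (hDc.continuousAt (Ioo_mem_nhds hx.1 hx.2))
  set K : ℝ → ℝ := fun x => ∫ t in x₀..x, D t with hK
  have hKc : ContinuousOn K (Ioo a b) := fun x hx => (hKd x hx).continuousAt.continuousWithinAt
  have hKl : LocallyIntegrableOn K (Ioo a b) := hKc.locallyIntegrableOn measurableSet_Ioo
  have hfK : LocallyIntegrableOn (fun x => f x - K x) (Ioo a b) := hf.sub hKl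
  have c1 : ∀ {η : ℝ → ℝ}, ContDiff ℝ (⊤ : ℕ∞) η → ContDiff ℝ (⊤ : ℕ∞) (deriv η) := fun h =>
    (contDiff_infty_iff_deriv.1 h).2
  -- `f - K` has vanishing second weak derivative
  have key : ∀ η : ℝ → ℝ, ContDiff ℝ (⊤ : ℕ∞) η → HasCompactSupport η → tsupport η ⊆ Ioo a b →
      ∫ x, (f x - K x) * deriv (deriv η) x = 0 := by
    intro η e1 e2 e3
    have s1 : tsupport (deriv η) ⊆ Ioo a b := tsupport_deriv_subset_of_subset e3
    have s2 : tsupport (deriv (deriv η)) ⊆ Ioo a b := tsupport_deriv_subset_of_subset s1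
    have i1 := integrable_mul_of_locallyIntegrableOn hf (c1 (c1 e1)).continuous e2.deriv.deriv s2
    have i2 := integrable_mul_of_locallyIntegrableOn hKl (c1 (c1 e1)).continuous e2.deriv.deriv s2
    simp_rw [sub_mul]
    rw [integral_sub i1 i2, H η e1 e2 e3,
      integral_mul_eq_neg_integral_primitive_mul_deriv hh hx₀ (e1.of_le one_le_infty) e2 e3 0]
    have := integral_deriv_mul_eq_neg hKd hDc ((c1 e1).of_le one_le_infty) e2.deriv s1
    simp only [zero_add]
    rw [this]
    ring
  obtain ⟨η₀, h1, h2, h3, h4⟩ := exists_bump_integral_eq_one hab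
  -- testing with the primitive of `η - (∫ η) η₀` shows that `f - K` has weak derivative `-C`
  set C := ∫ x, (f x - K x) * deriv η₀ x with hC
  obtain ⟨E, hE⟩ := ae_eq_const_of_integral_mul_deriv_eq_zero hab
    (f := fun x => f x - K x + C * x)
    (hfK.add ((continuous_const.mul continuous_id).continuousOn.locallyIntegrableOn
      measurableSet_Ioo)) (by
    intro η e1 e2 e3
    obtain ⟨ψ, p1, p2, p3, p4⟩ := exists_primitive_sub_mul_bump e1 e2 e3 h1 h2 h3 h4
    set I := ∫ x, η x with hI
    have k := key ψ p1 p2 p3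
    have hd : deriv (deriv ψ) = fun x => deriv η x - I * deriv η₀ x := by
      rw [p4]
      ext x
      have d1 := ((e1.differentiable (by simp)) x).hasDerivAt
      have d2 := ((h1.differentiable (by simp)) x).hasDerivAt
      exact (d1.sub (d2.const_mul I)).deriv
    rw [hd] at k
    have j1 := integrable_mul_of_locallyIntegrableOn hfK (c1 e1).continuous e2.deriv
      (tsupport_deriv_subset_of_subset e3)
    have j2 := integrable_mul_of_locallyIntegrableOn hfK (c1 h1).continuous h2.deriv
      (tsupport_deriv_subset_of_subset h3)
    have e : ∀ x, (f x - K x) * (deriv η x - I * deriv η₀ x)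
      = (f x - K x) * deriv η x - I * ((f x - K x) * deriv η₀ x) := fun x => by ring
    simp_rw [e] at k
    rw [integral_sub j1 (j2.const_mul _), integral_const_mul, ← hC] at k
    have j3 : Integrable fun x => C * x * deriv η x :=
      ((continuous_const.mul continuous_id).mul (c1 e1).continuous).integrable_of_hasCompactSupport
        e2.deriv.mul_left
    have j4 := integral_deriv_mul_eq_neg (F := fun x => C * x) (D := fun _ => C) (a := a) (b := b)
      (fun x _ => by simpa using (hasDerivAt_id x).const_mul C) continuousOn_const
      (e1.of_le one_le_infty) e2 e3
    rw [integral_const_mul, ← hI] at j4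
    have e' : ∀ x, (f x - K x + C * x) * deriv η x
      = (f x - K x) * deriv η x + C * x * deriv η x := fun x => by ring
    simp_rw [e']
    rw [integral_add j1 j3]
    linarith)
  refine ⟨fun x => E - C * x + K x, -C, ?_, continuousOn_const.add hDc, fun x hx => ?_⟩
  · filter_upwards [hE] with x hx hxm
    linarith [hx hxm]
  · have := (((hasDerivAt_id x).const_mul C).const_sub E).add (hKd x hx)
    rw [mul_one] at this
    exact this

/-! ### First and second variation of the energy -/

/-- Second-order Bernoulli inequality near `0`, with any constant below the Taylor coefficient. -/
theorem quadratic_le_rpow_one_add {q C : ℝ} (hC : C < q * (q - 1) / 2) :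
    ∀ᶠ y in 𝓝 (0 : ℝ), 1 + q * y + C * y ^ 2 ≤ (1 + y) ^ q := by
  set f : ℝ → ℝ := fun y => (1 + y) ^ q - (1 + q * y + C * y ^ 2) with hf
  have hne : ∀ᶠ y in 𝓝 (0 : ℝ), 1 + y ≠ 0 := by
    have : ContinuousAt (fun y : ℝ => 1 + y) 0 := by fun_prop
    exact this.eventually_ne (by norm_num)
  have h1 : ∀ᶠ y in 𝓝 (0 : ℝ),
      HasDerivAt f (q * (1 + y) ^ (q - 1) - (q + 2 * C * y)) y := by
    filter_upwards [hne] with y hy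
    have a := ((hasDerivAt_id y).const_add 1).rpow_const (p := q) (Or.inl hy)
    have b := (((hasDerivAt_id y).const_mul q).const_add 1).add ((hasDerivAt_pow 2 y).const_mul C)
    convert! a.sub b using 1
    simp
    ring
  have h2 : HasDerivAt (fun y : ℝ => q * (1 + y) ^ (q - 1) - (q + 2 * C * y))
      (q * (q - 1) - 2 * C) 0 := by
    have a := (((hasDerivAt_id (0 : ℝ)).const_add 1).rpow_const (p := q - 1)
      (Or.inl (by simp))).const_mul q
    have b := ((hasDerivAt_id (0 : ℝ)).const_mul (2 * C)).const_add q
    convert! a.sub b using 1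
    simp
  have hd : deriv f =ᶠ[𝓝 0] fun y => q * (1 + y) ^ (q - 1) - (q + 2 * C * y) :=
    h1.mono fun y hy => hy.deriv
  have hmin : IsLocalMin f 0 := by
    refine isLocalMin_of_deriv_deriv_pos ?_ ?_ h1.self_of_nhds.continuousAt
    · rw [hd.deriv_eq, h2.deriv]
      linarith
    · rw [hd.self_of_nhds]
      simp
  filter_upwards [hmin] with y hy
  simp only [hf] at hy
  norm_num at hy
  linarith

/-- Necessary second-order condition for a local minimum. -/
theorem deriv_eq_zero_and_nonneg_of_isLocalMin {F F' : ℝ → ℝ} {d : ℝ}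
    (h1 : ∀ᶠ x in 𝓝 (0 : ℝ), HasDerivAt F (F' x) x) (h2 : HasDerivAt F' d 0)
    (hm : IsLocalMin F 0) : F' 0 = 0 ∧ 0 ≤ d := by
  have h0 : F' 0 = 0 := hm.hasDerivAt_eq_zero h1.self_of_nhds
  refine ⟨h0, ?_⟩
  by_contra! hd
  have hde : deriv F =ᶠ[𝓝 0] F' := h1.mono fun y hy => hy.deriv
  have hmax : IsLocalMax F 0 := isLocalMax_of_deriv_deriv_neg
    (by rw [hde.deriv_eq, h2.deriv]; exact hd) (by rw [hde.self_of_nhds, h0])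
    h1.self_of_nhds.continuousAt
  have hc : F =ᶠ[𝓝 0] fun _ => F 0 := by
    filter_upwards [hm, hmax] with y a b
    exact le_antisymm b a
  have hc' : deriv F =ᶠ[𝓝 0] fun _ => 0 := by
    have := hc.deriv
    simpa using this
  have := (hde.symm.trans hc').deriv_eq
  rw [h2.deriv] at this
  simp at this
  linarith

section Scalar

variable {q s κ a₀ a₁ a₂ b₀ b₁ : ℝ}

/-! In the next lemmas `a₀ + a₁ ε + a₂ ε²` and `b₀ + b₁ ε` stand for the gradient term and the mass
term of the energy of `φ + ε ψ`, and `1 + q s ε + κ ε²` for a lower bound of `∫ (φ + ε ψ) ^ q`, by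
which the perturbation is normalized. -/

theorem hasDerivAt_scaled_energy (α β : ℝ) {x : ℝ} (hx : 0 < 1 + q * s * x + κ * x ^ 2) :
    HasDerivAt (fun x => (1 + q * s * x + κ * x ^ 2) ^ α * (a₀ + a₁ * x + a₂ * x ^ 2)
        + (1 + q * s * x + κ * x ^ 2) ^ β * (b₀ + b₁ * x))
      (((q * s + 2 * κ * x) * α * (1 + q * s * x + κ * x ^ 2) ^ (α - 1)
          * (a₀ + a₁ * x + a₂ * x ^ 2)
        + (1 + q * s * x + κ * x ^ 2) ^ α * (a₁ + 2 * a₂ * x))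
        + ((q * s + 2 * κ * x) * β * (1 + q * s * x + κ * x ^ 2) ^ (β - 1) * (b₀ + b₁ * x)
        + (1 + q * s * x + κ * x ^ 2) ^ β * b₁)) x := by
  have hP : ∀ c₀ c₁ c₂ : ℝ, HasDerivAt (fun x => c₀ + c₁ * x + c₂ * x ^ 2) (c₁ + 2 * c₂ * x) x := by
    intro c₀ c₁ c₂
    convert! (((hasDerivAt_id x).const_mul c₁).const_add c₀).add
      ((hasDerivAt_pow 2 x).const_mul c₂) using 1
    simp
    ring
  have hL : HasDerivAt (fun x => b₀ + b₁ * x) b₁ x := by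
    convert! ((hasDerivAt_id x).const_mul b₁).const_add b₀ using 1
    simp
  exact (((hP 1 (q * s) κ).rpow_const (Or.inl hx.ne')).mul (hP a₀ a₁ a₂)).add
    (((hP 1 (q * s) κ).rpow_const (Or.inl hx.ne')).mul hL)

theorem first_order_of_scaled_energy (hq : 0 < q)
    (h : ∀ᶠ ε in 𝓝[>] (0 : ℝ), a₀ + b₀ ≤ (1 + q * s * ε + κ * ε ^ 2) ^ (-(2 / q))
      * (a₀ + a₁ * ε + a₂ * ε ^ 2) + (1 + q * s * ε + κ * ε ^ 2) ^ (-(1 / q)) * (b₀ + b₁ * ε)) :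
    (2 * a₀ + b₀) * s ≤ a₁ + b₁ := by
  have hd := hasDerivAt_scaled_energy (q := q) (s := s) (κ := κ) (a₀ := a₀) (a₁ := a₁) (a₂ := a₂)
    (b₀ := b₀) (b₁ := b₁) (-(2 / q)) (-(1 / q)) (x := 0) (by simp)
  have := ge_of_tendsto (b := (0 : ℝ)) ((hasDerivAt_iff_tendsto_slope.1 hd).mono_left
    (nhdsWithin_mono 0 (fun x (hx : x ∈ Ioi (0 : ℝ)) => (ne_of_gt hx : x ≠ 0)))) (by
      filter_upwards [h, self_mem_nhdsWithin] with ε h1 h2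
      have h2 : 0 < ε := h2
      rw [slope_def_field]
      refine div_nonneg ?_ (by linarith)
      simp only [one_div] at h1
      simp
      linarith)
  simp at this
  have e : q * s * (2 / q) * a₀ = 2 * s * a₀ := by field_simp
  have e' : q * s * q⁻¹ * b₀ = s * b₀ := by field_simp
  linarith

theorem second_order_of_scaled_energy (hq : 0 < q)
    (h : ∀ᶠ ε in 𝓝 (0 : ℝ), a₀ + b₀ ≤ (1 + q * s * ε + κ * ε ^ 2) ^ (-(2 / q))
      * (a₀ + a₁ * ε + a₂ * ε ^ 2) + (1 + q * s * ε + κ * ε ^ 2) ^ (-(1 / q)) * (b₀ + b₁ * ε)) :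
    0 ≤ 2 * a₂ - 2 * (2 * a₀ + b₀) * κ / q
      + s ^ 2 * ((4 + 2 * q) * a₀ + (1 + q) * b₀ - 4 * (2 * a₀ + b₀)) + 2 * s * b₁ := by
  have hpos : ∀ᶠ x in 𝓝 (0 : ℝ), 0 < 1 + q * s * x + κ * x ^ 2 := by
    have : ContinuousAt (fun x : ℝ => 1 + q * s * x + κ * x ^ 2) 0 := by fun_prop
    exact this.eventually (lt_mem_nhds (by simp))
  have hd := hpos.mono fun x hx => hasDerivAt_scaled_energy (q := q) (s := s) (κ := κ) (a₀ := a₀)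
    (a₁ := a₁) (a₂ := a₂) (b₀ := b₀) (b₁ := b₁) (-(2 / q)) (-(1 / q)) hx
  have hP : ∀ c₀ c₁ c₂ : ℝ, HasDerivAt (fun x => c₀ + c₁ * x + c₂ * x ^ 2) c₁ 0 := by
    intro c₀ c₁ c₂
    convert! (((hasDerivAt_id (0 : ℝ)).const_mul c₁).const_add c₀).add
      ((hasDerivAt_pow 2 (0 : ℝ)).const_mul c₂) using 1
    simp
  have hL : ∀ c₀ c₁ : ℝ, HasDerivAt (fun x => c₀ + c₁ * x) c₁ 0 := by
    intro c₀ c₁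
    convert! ((hasDerivAt_id (0 : ℝ)).const_mul c₁).const_add c₀ using 1
    simp
  have hr : ∀ γ : ℝ, HasDerivAt (fun x => (1 + q * s * x + κ * x ^ 2) ^ γ) (q * s * γ) 0 := by
    intro γ
    convert! (hP 1 (q * s) κ).rpow_const (p := γ) (Or.inl (by simp)) using 1
    simp
  have hd2 := ((((((hL (q * s) (2 * κ)).mul_const (-(2 / q))).mul (hr (-(2 / q) - 1))).mul
    (hP a₀ a₁ a₂)).add ((hr (-(2 / q))).mul (hL a₁ (2 * a₂)))).add
    (((((hL (q * s) (2 * κ)).mul_const (-(1 / q))).mul (hr (-(1 / q) - 1))).mul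
    (hL b₀ b₁)).add ((hr (-(1 / q))).mul_const b₁)))
  obtain ⟨h1, h2⟩ := deriv_eq_zero_and_nonneg_of_isLocalMin hd hd2 (by
    filter_upwards [h] with x hx
    simpa using hx)
  simp at h1 h2
  have e : q * s * (2 / q) * a₀ = 2 * s * a₀ := by field_simp
  have e' : q * s * q⁻¹ * b₀ = s * b₀ := by field_simp
  have e1 : a₁ = (2 * a₀ + b₀) * s - b₁ := by linarith
  refine h2.trans (le_of_eq ?_)
  rw [e1]
  field_simp
  ring

end Scalar

theorem IsWeakDeriv.add {v w g k : ℝ → ℝ} (hv : IsWeakDeriv v g) (hw : IsWeakDeriv w k) :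
    IsWeakDeriv (fun x => v x + w x) (fun x => g x + k x) where
  locInt := hv.locInt.add hw.locInt
  locInt_deriv := hv.locInt_deriv.add hw.locInt_deriv
  integral_eq η h1 h2 := by
    have c : Continuous (deriv η) := (contDiff_infty_iff_deriv.1 h1).2.continuous
    have i : ∀ {f ζ : ℝ → ℝ}, LocallyIntegrable f → Continuous ζ → HasCompactSupport ζ →
        Integrable fun x => f x * ζ x := fun hf hζ hc => by
      simpa [mul_comm] using! hf.integrable_smul_left_of_hasCompactSupport hζ hc
    simp_rw [add_mul]
    rw [integral_add (i hv.locInt c h2.deriv) (i hw.locInt c h2.deriv),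
      integral_add (i hv.locInt_deriv h1.continuous h2) (i hw.locInt_deriv h1.continuous h2),
      hv.integral_eq η h1 h2, hw.integral_eq η h1 h2]
    ring

theorem IsWeakDeriv.const_mul {v g : ℝ → ℝ} (hv : IsWeakDeriv v g) (c : ℝ) :
    IsWeakDeriv (fun x => c * v x) (fun x => c * g x) where
  locInt := hv.locInt.smul c
  locInt_deriv := hv.locInt_deriv.smul c
  integral_eq η h1 h2 := by
    simp_rw [mul_assoc]
    rw [integral_const_mul, integral_const_mul, hv.integral_eq η h1 h2]
    ring

theorem isWeakDeriv_of_contDiff {ψ : ℝ → ℝ} (hψ : ContDiff ℝ 1 ψ) : IsWeakDeriv ψ (deriv ψ) where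
  locInt := hψ.continuous.locallyIntegrable
  locInt_deriv := (hψ.continuous_deriv le_rfl).locallyIntegrable
  integral_eq η h1 h2 := by
    have c : Continuous (deriv η) := (contDiff_infty_iff_deriv.1 h1).2.continuous
    exact integral_mul_deriv_eq_deriv_mul_of_integrable
      (fun x _ => (hψ.differentiable one_ne_zero x).hasDerivAt)
      (fun x _ => (h1.differentiable (by simp) x).hasDerivAt)
      ((hψ.continuous.mul c).integrable_of_hasCompactSupport h2.deriv.mul_left)
      (((hψ.continuous_deriv le_rfl).mul h1.continuous).integrable_of_hasCompactSupport
        h2.mul_left)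
      ((hψ.continuous.mul h1.continuous).integrable_of_hasCompactSupport h2.mul_left)

/-- The standing assumptions: `φ` is a continuous bell-shaped minimizer, with weak derivative
`g`. -/
structure BellMinimizer (p ω : ℝ) (φ g : ℝ → ℝ) : Prop where
  two_lt : 2 < p
  ω_pos : 0 < ω
  cont : Continuous φ
  bell : BellShaped φ
  adm : AdmissibleV p φ g
  minimal : ∀ w k, AdmissibleV p w k → energyV ω φ g ≤ energyV ω w k

/-- The Lagrange multiplier `c = (1/2) ∫ |φ'|² + ω ∫ φ` in terms of the minimizer `φ` and its
weak derivative `g`. -/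
noncomputable def lagrange (ω : ℝ) (φ g : ℝ → ℝ) : ℝ := (1 / 2) * (∫ x, g x ^ 2) + ω * ∫ x, φ x

namespace BellMinimizer

variable {p ω : ℝ} {φ g : ℝ → ℝ}

theorem one_lt_half (H : BellMinimizer p ω φ g) : 1 < p / 2 := by linarith [H.two_lt]

theorem nonneg (H : BellMinimizer p ω φ g) (x : ℝ) : 0 ≤ φ x := H.bell.nonneg x

theorem integral_rpow (H : BellMinimizer p ω φ g) : ∫ x, φ x ^ (p / 2) = 1 := by
  rw [← H.adm.constraint]
  simp_rw [abs_of_nonneg (H.nonneg _)]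

theorem integrable_rpow (H : BellMinimizer p ω φ g) : Integrable fun x => φ x ^ (p / 2) := by
  by_contra h
  have := integral_undef h
  rw [H.integral_rpow] at this
  exact one_ne_zero this

/-- Minimality, tested with a perturbation of `φ` rescaled so as to satisfy the constraint. The
constraint integral may be replaced by a lower bound `P`, because scaling up increases the
energy. -/
theorem le_of_perturbation (H : BellMinimizer p ω φ g) {ψ : ℝ → ℝ} (hψ : ContDiff ℝ 1 ψ)
    (hc : HasCompactSupport ψ) {ε P : ℝ} (hpos : ∀ x, 0 ≤ φ x + ε * ψ x) (hP : 0 < P)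
    (hPM : P ≤ ∫ x, (φ x + ε * ψ x) ^ (p / 2)) :
    (1 / 4) * (∫ x, g x ^ 2) + ω * ∫ x, φ x ≤
      P ^ (-(2 / (p / 2))) * ((1 / 4) * (∫ x, g x ^ 2) + (1 / 2) * (∫ x, g x * deriv ψ x) * ε
        + (1 / 4) * (∫ x, deriv ψ x ^ 2) * ε ^ 2)
      + P ^ (-(1 / (p / 2))) * (ω * (∫ x, φ x) + ω * (∫ x, ψ x) * ε) := by
  have hq : 0 < p / 2 := by linarith [H.one_lt_half]
  set M := ∫ x, (φ x + ε * ψ x) ^ (p / 2) with hM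
  have hM0 : 0 < M := hP.trans_le hPM
  set s := M ^ (-(1 / (p / 2))) with hs
  have hs0 : 0 < s := Real.rpow_pos_of_pos hM0 _
  have c' : Continuous (deriv ψ) := hψ.continuous_deriv le_rfl
  have m1 : MemLp ψ 2 := hψ.continuous.memLp_of_hasCompactSupport hc
  have m2 : MemLp (deriv ψ) 2 := c'.memLp_of_hasCompactSupport hc.deriv
  have i1 : Integrable ψ := hψ.continuous.integrable_of_hasCompactSupport hc
  have adm : AdmissibleV p (fun x => s * (φ x + ε * ψ x)) (fun x => s * (g x + ε * deriv ψ x)) :=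
    { integrable := (H.adm.integrable.add (i1.const_mul ε)).const_mul s
      memL2 := (H.adm.memL2.add (m1.const_mul ε)).const_mul s
      memL2_deriv := (H.adm.memL2_deriv.add (m2.const_mul ε)).const_mul s
      weakDeriv := (H.adm.weakDeriv.add ((isWeakDeriv_of_contDiff hψ).const_mul ε)).const_mul s
      constraint := by
        have e : ∀ x, |s * (φ x + ε * ψ x)| ^ (p / 2) = M⁻¹ * (φ x + ε * ψ x) ^ (p / 2) := by
          intro x
          rw [abs_of_nonneg (mul_nonneg hs0.le (hpos x)), Real.mul_rpow hs0.le (hpos x), hs,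
            ← Real.rpow_mul hM0.le]
          have : -(1 / (p / 2)) * (p / 2) = -1 := by
            rw [neg_mul, one_div, inv_mul_cancel₀ hq.ne']
          rw [this, Real.rpow_neg_one]
        simp_rw [e]
        rw [integral_const_mul, ← hM, inv_mul_cancel₀ hM0.ne'] }
  have hmin := H.minimal _ _ adm
  have g2 : Integrable fun x => g x ^ 2 := H.adm.memL2_deriv.integrable_sq
  have d2 : Integrable fun x => deriv ψ x ^ 2 := m2.integrable_sq
  have gd : Integrable fun x => g x * deriv ψ x := H.adm.memL2_deriv.integrable_mul m2
  have eA : ∫ x, (s * (g x + ε * deriv ψ x)) ^ 2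
      = s ^ 2 * ((∫ x, g x ^ 2) + 2 * ε * (∫ x, g x * deriv ψ x) + ε ^ 2 * ∫ x, deriv ψ x ^ 2) := by
    have e : ∀ x, (s * (g x + ε * deriv ψ x)) ^ 2
        = s ^ 2 * (g x ^ 2 + 2 * ε * (g x * deriv ψ x) + ε ^ 2 * deriv ψ x ^ 2) := fun x => by ring
    simp_rw [e]
    rw [integral_const_mul, integral_add (g2.fun_add (gd.const_mul _)) (d2.const_mul _),
      integral_add g2 (gd.const_mul _), integral_const_mul, integral_const_mul]
  have eB : ∫ x, |s * (φ x + ε * ψ x)| = s * ((∫ x, φ x) + ε * ∫ x, ψ x) := by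
    have e : ∀ x, |s * (φ x + ε * ψ x)| = s * (φ x + ε * ψ x) := fun x =>
      abs_of_nonneg (mul_nonneg hs0.le (hpos x))
    simp_rw [e]
    rw [integral_const_mul, integral_add H.adm.integrable (i1.const_mul _), integral_const_mul]
  unfold energyV at hmin
  simp_rw [abs_of_nonneg (H.nonneg _)] at hmin
  rw [eA, eB] at hmin
  have hA0 : 0 ≤ (∫ x, g x ^ 2) + 2 * ε * (∫ x, g x * deriv ψ x)
      + ε ^ 2 * ∫ x, deriv ψ x ^ 2 := by
    have : 0 ≤ s ^ 2 * ((∫ x, g x ^ 2) + 2 * ε * (∫ x, g x * deriv ψ x)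
      + ε ^ 2 * ∫ x, deriv ψ x ^ 2) := eA ▸ integral_nonneg fun x => sq_nonneg _
    exact nonneg_of_mul_nonneg_right this (by positivity)
  have hB0 : 0 ≤ (∫ x, φ x) + ε * ∫ x, ψ x := by
    have : 0 ≤ s * ((∫ x, φ x) + ε * ∫ x, ψ x) := eB ▸ integral_nonneg fun x => abs_nonneg _
    exact nonneg_of_mul_nonneg_right this hs0
  have hs2 : s ^ 2 = M ^ (-(2 / (p / 2))) := by
    rw [hs, ← Real.rpow_natCast, ← Real.rpow_mul hM0.le]
    congr 1
    push_cast
    ring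
  have k1 : s ^ 2 ≤ P ^ (-(2 / (p / 2))) := by
    rw [hs2]
    exact Real.rpow_le_rpow_of_nonpos hP hPM (by
      have : 0 < 2 / (p / 2) := by positivity
      linarith)
  have k2 : s ≤ P ^ (-(1 / (p / 2))) := by
    exact Real.rpow_le_rpow_of_nonpos hP hPM (by
      have : 0 < 1 / (p / 2) := by positivity
      linarith)
  have l1 := mul_le_mul_of_nonneg_right k1 hA0
  have l2 := mul_le_mul_of_nonneg_left (mul_le_mul_of_nonneg_right k2 hB0) H.ω_pos.le
  linarith

theorem integrable_perturbation_rpow (H : BellMinimizer p ω φ g) {ψ : ℝ → ℝ} (hψ : Continuous ψ)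
    (hc : HasCompactSupport ψ) (ε : ℝ) :
    Integrable fun x => (φ x + ε * ψ x) ^ (p / 2) := by
  have hq : 0 ≤ p / 2 := by linarith [H.one_lt_half]
  have h : Integrable fun x => (φ x + ε * ψ x) ^ (p / 2) - φ x ^ (p / 2) := by
    refine Continuous.integrable_of_hasCompactSupport ?_ ?_
    · exact ((H.cont.add (continuous_const.mul hψ)).rpow_const fun _ => Or.inr hq).sub
        (H.cont.rpow_const fun _ => Or.inr hq)
    · refine HasCompactSupport.of_support_subset_isCompact hc.isCompact fun x hx => ?_
      by_contra hn
      exact hx (by simp [image_eq_zero_of_notMem_tsupport hn])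
  exact (h.add H.integrable_rpow).congr (Eventually.of_forall fun x => by simp)

theorem continuous_rpow_sub_one (H : BellMinimizer p ω φ g) :
    Continuous fun x => φ x ^ (p / 2 - 1) :=
  H.cont.rpow_const fun _ => Or.inr (by linarith [H.one_lt_half])

/-- The one-sided first variation, for perturbations that keep `φ` nonnegative; they may be
supported across the edge of the support of `φ`. -/
theorem first_variation_le (H : BellMinimizer p ω φ g) {η : ℝ → ℝ} (hη : ContDiff ℝ 1 η)
    (hc : HasCompactSupport η) (hpos : ∀ᶠ ε in 𝓝[>] (0 : ℝ), ∀ x, 0 ≤ φ x + ε * η x) :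
    lagrange ω φ g * ∫ x, φ x ^ (p / 2 - 1) * η x
      ≤ (1 / 2) * (∫ x, g x * deriv η x) + ω * ∫ x, η x := by
  have hq := H.one_lt_half
  set s := ∫ x, φ x ^ (p / 2 - 1) * η x with hs
  have hi : Integrable fun x => φ x ^ (p / 2 - 1) * η x :=
    (H.continuous_rpow_sub_one.mul hη.continuous).integrable_of_hasCompactSupport hc.mul_left
  have key := first_order_of_scaled_energy (q := p / 2) (s := s) (κ := 0)
    (a₀ := (1 / 4) * (∫ x, g x ^ 2)) (a₁ := (1 / 2) * (∫ x, g x * deriv η x))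
    (a₂ := (1 / 4) * (∫ x, deriv η x ^ 2)) (b₀ := ω * ∫ x, φ x) (b₁ := ω * ∫ x, η x)
    (by linarith) (by
      have hPp : ∀ᶠ ε in 𝓝[>] (0 : ℝ), 0 < 1 + p / 2 * s * ε + 0 * ε ^ 2 := by
        have : ContinuousAt (fun x : ℝ => 1 + p / 2 * s * x + 0 * x ^ 2) 0 := by fun_prop
        exact nhdsWithin_le_nhds (this.eventually (lt_mem_nhds (by simp)))
      filter_upwards [hpos, hPp, self_mem_nhdsWithin] with ε h1 h2 h3
      refine H.le_of_perturbation hη hc h1 h2 ?_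
      -- Bernoulli's inequality bounds the constraint from below
      have e : 1 + p / 2 * s * ε + 0 * ε ^ 2
          = ∫ x, (φ x ^ (p / 2) + p / 2 * ε * (φ x ^ (p / 2 - 1) * η x)) := by
        rw [integral_add H.integrable_rpow (hi.const_mul _), integral_const_mul, H.integral_rpow]
        ring
      rw [e]
      refine integral_mono (H.integrable_rpow.add (hi.const_mul _))
        (H.integrable_perturbation_rpow hη.continuous hc ε) fun x => ?_
      beta_reduce
      rcases (H.nonneg x).eq_or_lt with h0 | h0
      · rw [← h0, Real.zero_rpow (by linarith), Real.zero_rpow (by linarith)]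
        simpa [← h0] using Real.rpow_nonneg (h1 x) (p / 2)
      · have hy : -1 ≤ ε * η x / φ x := by
          rw [le_div_iff₀ h0]
          linarith [h1 x]
        have hb := one_add_mul_self_le_rpow_one_add hy hq.le
        have e1 : φ x + ε * η x = φ x * (1 + ε * η x / φ x) := by field_simp
        rw [e1, Real.mul_rpow h0.le (by linarith)]
        refine le_trans (le_of_eq ?_)
          (mul_le_mul_of_nonneg_left hb (Real.rpow_nonneg h0.le (p / 2)))
        rw [Real.rpow_sub_one h0.ne']
        field_simp)
  unfold lagrange
  linarith

theorem exists_bound_of_tsupport_subset (H : BellMinimizer p ω φ g) {ψ : ℝ → ℝ} (hψ : Continuous ψ)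
    (hc : HasCompactSupport ψ) (hs : tsupport ψ ⊆ Function.support φ) :
    ∃ C : ℝ, 0 < C ∧ ∀ x, |ψ x| ≤ C * φ x := by
  have h : ContinuousOn (fun x => ψ x / φ x) (tsupport ψ) :=
    hψ.continuousOn.div H.cont.continuousOn fun x hx => hs hx
  obtain ⟨C, hC⟩ := hc.isCompact.exists_bound_of_continuousOn h
  refine ⟨max C 1, by positivity, fun x => ?_⟩
  by_cases hx : x ∈ tsupport ψ
  · have hp : 0 < φ x := lt_of_le_of_ne (H.nonneg x) (Ne.symm (hs hx))
    have := hC x hx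
    rw [Real.norm_eq_abs, abs_div, abs_of_pos hp, div_le_iff₀ hp] at this
    exact this.trans (mul_le_mul_of_nonneg_right (le_max_left _ _) hp.le)
  · rw [image_eq_zero_of_notMem_tsupport hx, abs_zero]
    exact mul_nonneg (by positivity) (H.nonneg x)

theorem eventually_abs_le (H : BellMinimizer p ω φ g) {ψ : ℝ → ℝ} (hψ : Continuous ψ)
    (hc : HasCompactSupport ψ) (hs : tsupport ψ ⊆ Function.support φ) {δ : ℝ} (hδ : 0 < δ) :
    ∀ᶠ ε in 𝓝 (0 : ℝ), ∀ x, |ε * ψ x| ≤ δ * φ x := by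
  obtain ⟨C, hC, h⟩ := H.exists_bound_of_tsupport_subset hψ hc hs
  have : ∀ᶠ ε in 𝓝 (0 : ℝ), |ε| < δ / C := by
    have := (continuous_abs (G := ℝ)).tendsto 0
    rw [abs_zero] at this
    exact this.eventually (gt_mem_nhds (by positivity))
  filter_upwards [this] with ε hε x
  rw [abs_mul]
  calc |ε| * |ψ x| ≤ (δ / C) * (C * φ x) :=
        mul_le_mul hε.le (h x) (abs_nonneg _) (by positivity)
    _ = δ * φ x := by field_simp

/-- The weak Euler-Lagrange equation on the positivity set. -/
theorem first_variation (H : BellMinimizer p ω φ g) {η : ℝ → ℝ} (hη : ContDiff ℝ 1 η)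
    (hc : HasCompactSupport η) (hs : tsupport η ⊆ Function.support φ) :
    (1 / 2) * (∫ x, g x * deriv η x) + ω * ∫ x, η x
      = lagrange ω φ g * ∫ x, φ x ^ (p / 2 - 1) * η x := by
  have hev := H.eventually_abs_le hη.continuous hc hs one_pos
  refine le_antisymm ?_ (H.first_variation_le hη hc (nhdsWithin_le_nhds ?_))
  · have hts : HasCompactSupport (fun x => -η x) := hc.neg
    have := H.first_variation_le hη.neg hts (nhdsWithin_le_nhds ?_)
    · have hd : deriv (fun x => -η x) = fun x => -deriv η x := funext fun x => deriv.fun_neg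
      rw [hd] at this
      simp only [mul_neg, integral_neg] at this
      linarith
    · filter_upwards [hev] with ε h x
      linarith [abs_le.1 (h x)]
  · filter_upwards [hev] with ε h x
    linarith [abs_le.1 (h x)]

/-- The second variation, tested with arbitrary perturbations supported in the positivity set.
The perturbations tangent to the constraint are those with `∫ φ ^ (p / 2 - 1) ψ = 0`; keeping the
terms that vanish for them avoids correcting approximations of tangent perturbations. -/
theorem second_variation (H : BellMinimizer p ω φ g) :
    ∃ K : ℝ, ∀ ψ : ℝ → ℝ, ContDiff ℝ 1 ψ → HasCompactSupport ψ →
      tsupport ψ ⊆ Function.support φ →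
      0 ≤ (∫ x, deriv ψ x ^ 2)
        - (p - 2) * lagrange ω φ g * (∫ x, φ x ^ (p / 2 - 2) * ψ x ^ 2)
        + K * (∫ x, φ x ^ (p / 2 - 1) * ψ x) ^ 2
        + 4 * ω * (∫ x, φ x ^ (p / 2 - 1) * ψ x) * ∫ x, ψ x := by
  have hq := H.one_lt_half
  refine ⟨2 * ((4 + 2 * (p / 2)) * ((1 / 4) * (∫ x, g x ^ 2)) + (1 + p / 2) * (ω * ∫ x, φ x)
    - 4 * (2 * ((1 / 4) * (∫ x, g x ^ 2)) + ω * ∫ x, φ x)), fun ψ hψ hc hs => ?_⟩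
  set s := ∫ x, φ x ^ (p / 2 - 1) * ψ x with hsdef
  set J := ∫ x, φ x ^ (p / 2 - 2) * ψ x ^ 2 with hJ
  have hi : Integrable fun x => φ x ^ (p / 2 - 1) * ψ x :=
    (H.continuous_rpow_sub_one.mul hψ.continuous).integrable_of_hasCompactSupport hc.mul_left
  have hi2 : Integrable fun x => φ x ^ (p / 2 - 2) * ψ x ^ 2 := by
    have hon : ContinuousOn (fun x => φ x ^ (p / 2 - 2) * ψ x ^ 2) (tsupport ψ) :=
      (H.cont.continuousOn.rpow_const fun x hx => Or.inl (hs hx)).mul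
        (hψ.continuous.pow 2).continuousOn
    refine (integrableOn_iff_integrable_of_support_subset fun x hx => ?_).1
      (hon.integrableOn_compact hc.isCompact)
    by_contra hn
    exact hx (by simp [image_eq_zero_of_notMem_tsupport hn])
  have key : ∀ θ : ℝ, 0 < θ → 0 ≤ 2 * ((1 / 4) * (∫ x, deriv ψ x ^ 2))
      - 2 * (2 * ((1 / 4) * (∫ x, g x ^ 2)) + ω * ∫ x, φ x)
        * ((p / 2 * (p / 2 - 1) / 2 - θ) * J) / (p / 2)
      + s ^ 2 * ((4 + 2 * (p / 2)) * ((1 / 4) * (∫ x, g x ^ 2)) + (1 + p / 2) * (ω * ∫ x, φ x)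
        - 4 * (2 * ((1 / 4) * (∫ x, g x ^ 2)) + ω * ∫ x, φ x)) + 2 * s * (ω * ∫ x, ψ x) := by
    intro θ hθ
    refine second_order_of_scaled_energy (a₁ := (1 / 2) * (∫ x, g x * deriv ψ x))
      (by linarith) ?_
    set κ := (p / 2 * (p / 2 - 1) / 2 - θ) * J with hκ
    -- the relative size `ε ψ / φ` of the perturbation is uniformly small on the support of `ψ`
    obtain ⟨δ, hδ, hδy⟩ := Metric.eventually_nhds_iff.1
      (quadratic_le_rpow_one_add (q := p / 2) (C := p / 2 * (p / 2 - 1) / 2 - θ) (by linarith))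
    have hδ' : 0 < min (δ / 2) 1 := by positivity
    have hPp : ∀ᶠ ε in 𝓝 (0 : ℝ), 0 < 1 + p / 2 * s * ε + κ * ε ^ 2 := by
      have : ContinuousAt (fun x : ℝ => 1 + p / 2 * s * x + κ * x ^ 2) 0 := by fun_prop
      exact this.eventually (lt_mem_nhds (by simp))
    filter_upwards [hPp, H.eventually_abs_le hψ.continuous hc hs hδ'] with ε h2 h3
    have h1 : ∀ x, 0 ≤ φ x + ε * ψ x := fun x => by
      have := abs_le.1 (h3 x)
      have h4 := mul_le_mul_of_nonneg_right (min_le_right (δ / 2) 1) (H.nonneg x)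
      linarith
    refine H.le_of_perturbation hψ hc h1 h2 ?_
    have e : 1 + p / 2 * s * ε + κ * ε ^ 2
        = ∫ x, (φ x ^ (p / 2) + p / 2 * ε * (φ x ^ (p / 2 - 1) * ψ x)
          + (p / 2 * (p / 2 - 1) / 2 - θ) * ε ^ 2 * (φ x ^ (p / 2 - 2) * ψ x ^ 2)) := by
      rw [integral_add (H.integrable_rpow.fun_add (hi.const_mul _)) (hi2.const_mul _),
        integral_add H.integrable_rpow (hi.const_mul _), integral_const_mul, integral_const_mul,
        H.integral_rpow]
      ring
    rw [e]
    refine integral_mono ((H.integrable_rpow.add (hi.const_mul _)).add (hi2.const_mul _))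
      (H.integrable_perturbation_rpow hψ.continuous hc ε) fun x => ?_
    beta_reduce
    by_cases hx : x ∈ tsupport ψ
    · have h0 : 0 < φ x := lt_of_le_of_ne (H.nonneg x) (Ne.symm (hs hx))
      have hy : |ε * ψ x / φ x| ≤ min (δ / 2) 1 := by
        rw [abs_div, abs_of_pos h0, div_le_iff₀ h0]
        exact h3 x
      have hb := hδy (y := ε * ψ x / φ x) (by
        rw [Real.dist_eq, sub_zero]
        exact hy.trans_lt ((min_le_left _ _).trans_lt (by linarith)))
      have hy' : 0 ≤ 1 + ε * ψ x / φ x := by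
        linarith [(abs_le.1 (hy.trans (min_le_right _ _))).1]
      have e1 : φ x + ε * ψ x = φ x * (1 + ε * ψ x / φ x) := by field_simp
      rw [e1, Real.mul_rpow h0.le hy']
      refine le_trans (le_of_eq ?_)
        (mul_le_mul_of_nonneg_left hb (Real.rpow_nonneg h0.le (p / 2)))
      have e2 : φ x ^ (p / 2 - 2) = φ x ^ (p / 2) / φ x ^ 2 := by
        rw [Real.rpow_sub h0]
        norm_num
      rw [Real.rpow_sub_one h0.ne', e2]
      field_simp
    · simp [image_eq_zero_of_notMem_tsupport hx]
  have lim : Tendsto (fun θ : ℝ => 2 * ((1 / 4) * (∫ x, deriv ψ x ^ 2))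
      - 2 * (2 * ((1 / 4) * (∫ x, g x ^ 2)) + ω * ∫ x, φ x)
        * ((p / 2 * (p / 2 - 1) / 2 - θ) * J) / (p / 2)
      + s ^ 2 * ((4 + 2 * (p / 2)) * ((1 / 4) * (∫ x, g x ^ 2)) + (1 + p / 2) * (ω * ∫ x, φ x)
        - 4 * (2 * ((1 / 4) * (∫ x, g x ^ 2)) + ω * ∫ x, φ x)) + 2 * s * (ω * ∫ x, ψ x))
      (𝓝[>] 0) (𝓝 _) := (Continuous.tendsto (by fun_prop) 0).mono_left nhdsWithin_le_nhds
  have := ge_of_tendsto lim (eventually_nhdsWithin_of_forall fun θ hθ => key θ hθ)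
  have hp0 : p ≠ 0 := by linarith [H.two_lt]
  unfold lagrange
  have e : ∀ X : ℝ, X * ((p / 2 * (p / 2 - 1) / 2 - 0) * J) / (p / 2) = X * ((p - 2) / 4 * J) := by
    intro X
    field_simp
    ring
  rw [e] at this
  linarith

end BellMinimizer

/-! ### The profile of the minimizer -/

theorem tendsto_integral_mul_translate {θ ζ : ℝ → ℝ} (hθ : Continuous θ) {B : ℝ}
    (hB : ∀ x, |θ x| ≤ B) (h0 : Tendsto θ atTop (𝓝 0)) (hζ : Continuous ζ)
    (hc : HasCompactSupport ζ) :
    Tendsto (fun R : ℝ => ∫ x, θ x * ζ (x - R)) atTop (𝓝 0) := by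
  have e : ∀ R : ℝ, ∫ x, θ x * ζ (x - R) = ∫ x, θ (x + R) * ζ x := fun R => by
    rw [← integral_add_right_eq_self _ R]
    simp
  simp_rw [e]
  have : (0 : ℝ) = ∫ x, 0 * ζ x := by simp
  rw [this]
  refine tendsto_integral_filter_of_dominated_convergence (fun x => B * |ζ x|) ?_ ?_ ?_ ?_
  · exact Eventually.of_forall fun R =>
      ((hθ.comp (continuous_add_const R)).mul hζ).aestronglyMeasurable
  · refine Eventually.of_forall fun R => Eventually.of_forall fun x => ?_
    rw [norm_mul]
    exact mul_le_mul_of_nonneg_right (hB _) (abs_nonneg _)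
  · exact ((hζ.integrable_of_hasCompactSupport hc).abs).const_mul B
  · exact Eventually.of_forall fun x =>
      (h0.comp (tendsto_atTop_add_const_left atTop x tendsto_id)).mul_const _

namespace BellMinimizer

variable {p ω : ℝ} {φ g : ℝ → ℝ}

theorem apply_abs (H : BellMinimizer p ω φ g) (x : ℝ) : φ |x| = φ x := by
  rcases abs_choice x with h | h <;> rw [h]
  exact H.bell.even x

theorem le_of_abs_le (H : BellMinimizer p ω φ g) {x y : ℝ} (h : |x| ≤ |y|) : φ y ≤ φ x := by
  rw [← H.apply_abs x, ← H.apply_abs y]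
  rcases (abs_nonneg x).eq_or_lt with h0 | h0
  · rw [← h0]
    rcases (abs_nonneg y).eq_or_lt with h1 | h1
    · rw [← h1]
    · have ht : Tendsto φ (𝓝[>] 0) (𝓝 (φ 0)) := (H.cont.tendsto 0).mono_left nhdsWithin_le_nhds
      refine ge_of_tendsto ht ?_
      filter_upwards [Ioo_mem_nhdsGT h1] with t ht
      exact H.bell.anti ht.1 h1 ht.2.le
  · exact H.bell.anti h0 (h0.trans_le h) h

theorem apply_zero_pos (H : BellMinimizer p ω φ g) : 0 < φ 0 := by
  refine lt_of_le_of_ne (H.nonneg 0) fun h => ?_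
  have h0 : ∀ x, φ x = 0 := fun x =>
    le_antisymm (h ▸ H.le_of_abs_le (by simp)) (H.nonneg x)
  have := H.integral_rpow
  simp [h0, Real.zero_rpow (show p / 2 ≠ 0 by linarith [H.one_lt_half])] at this

theorem tendsto_atTop (H : BellMinimizer p ω φ g) : Tendsto φ atTop (𝓝 0) := by
  have hb : ∀ x : ℝ, 0 < x → φ x ≤ (∫ t, φ t) / x := by
    intro x hx
    rw [le_div_iff₀ hx]
    calc φ x * x = ∫ _ in Ioc 0 x, φ x := by simp [hx.le, mul_comm]
      _ ≤ ∫ t in Ioc 0 x, φ t := by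
        refine setIntegral_mono_on (integrableOn_const (by simp)) H.adm.integrable.integrableOn
          measurableSet_Ioc fun t ht => H.le_of_abs_le ?_
        rw [abs_of_pos ht.1, abs_of_pos hx]
        exact ht.2
      _ ≤ ∫ t, φ t := setIntegral_le_integral H.adm.integrable (Eventually.of_forall H.nonneg)
  refine tendsto_of_tendsto_of_tendsto_of_le_of_le' tendsto_const_nhds
    ((tendsto_const_nhds (x := ∫ t, φ t)).div_atTop tendsto_id) (Eventually.of_forall H.nonneg) ?_
  filter_upwards [eventually_gt_atTop 0] with x hx using hb x hx

/-- The minimizer has compact support: far away, positivity would force `φ'' ≈ 2 ω > 0`. -/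
theorem exists_zero (H : BellMinimizer p ω φ g) : ∃ x, φ x = 0 := by
  by_contra! hne
  obtain ⟨η, h1, h2, -, h4⟩ := exists_bump_integral_eq_one (zero_lt_one (α := ℝ))
  have c1 : ContDiff ℝ (⊤ : ℕ∞) (deriv η) := (contDiff_infty_iff_deriv.1 h1).2
  have c2 : ContDiff ℝ (⊤ : ℕ∞) (deriv (deriv η)) := (contDiff_infty_iff_deriv.1 c1).2
  have hq := H.one_lt_half
  -- if `φ` had no zero, the equation could be tested with translates of `η` moving off to infinity
  have key : ∀ R : ℝ, -(1 / 2) * (∫ x, φ x * deriv (deriv η) (x - R)) + ω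
      = lagrange ω φ g * ∫ x, φ x ^ (p / 2 - 1) * η (x - R) := by
    intro R
    have hR : ContDiff ℝ (⊤ : ℕ∞) fun x => η (x - R) := h1.comp (contDiff_id.sub contDiff_const)
    have hRc : HasCompactSupport fun x => η (x - R) :=
      h2.comp_homeomorph (Homeomorph.subRight R)
    have hR' : ContDiff ℝ (⊤ : ℕ∞) fun x => deriv η (x - R) :=
      c1.comp (contDiff_id.sub contDiff_const)
    have hRc' : HasCompactSupport fun x => deriv η (x - R) :=
      h2.deriv.comp_homeomorph (Homeomorph.subRight R)
    have d1 : deriv (fun x => η (x - R)) = fun x => deriv η (x - R) :=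
      funext fun x => deriv_comp_sub_const _ _ _
    have d2 : deriv (fun x => deriv η (x - R)) = fun x => deriv (deriv η) (x - R) :=
      funext fun x => deriv_comp_sub_const _ _ _
    have fv := H.first_variation (hR.of_le one_le_infty) hRc fun x _ => hne x
    have wd := H.adm.weakDeriv.integral_eq _ hR' hRc'
    rw [d2] at wd
    rw [d1, integral_sub_right_eq_self η R, h4] at fv
    linarith
  have t1 := tendsto_integral_mul_translate H.cont (B := φ 0)
    (fun x => by rw [abs_of_nonneg (H.nonneg x)]; exact H.le_of_abs_le (by simp)) H.tendsto_atTop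
    c2.continuous h2.deriv.deriv
  have t2 := tendsto_integral_mul_translate H.continuous_rpow_sub_one (B := φ 0 ^ (p / 2 - 1))
    (fun x => by
      rw [abs_of_nonneg (Real.rpow_nonneg (H.nonneg x) _)]
      exact Real.rpow_le_rpow (H.nonneg x) (H.le_of_abs_le (by simp)) (by linarith))
    (by
      have := H.tendsto_atTop.rpow_const (p := p / 2 - 1) (Or.inr (by linarith))
      rwa [Real.zero_rpow (by linarith)] at this)
    h1.continuous h2
  have t3 := (t1.const_mul (-(1 / 2))).add_const ω
  simp_rw [key] at t3
  have := tendsto_nhds_unique t3 (t2.const_mul _)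
  have hω := H.ω_pos
  simp at this
  linarith

theorem exists_support_eq (H : BellMinimizer p ω φ g) :
    ∃ L, 0 < L ∧ Function.support φ = Ioo (-L) L := by
  set Z := {x : ℝ | 0 ≤ x ∧ φ x = 0} with hZ
  have hcl : IsClosed Z := isClosed_Ici.inter (isClosed_eq H.cont continuous_const)
  have hbd : BddBelow Z := ⟨0, fun x hx => hx.1⟩
  have hne : Z.Nonempty := by
    obtain ⟨x, hx⟩ := H.exists_zero
    exact ⟨|x|, abs_nonneg x, by rw [H.apply_abs, hx]⟩
  have hm : sInf Z ∈ Z := hcl.csInf_mem hne hbd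
  refine ⟨sInf Z, lt_of_le_of_ne hm.1 fun h => ?_, ?_⟩
  · have h0 := hm.2
    rw [← h] at h0
    exact H.apply_zero_pos.ne' h0
  · ext x
    rw [mem_Ioo, ← abs_lt, Function.mem_support]
    constructor
    · intro hx
      by_contra! hn
      refine hx (le_antisymm ?_ (H.nonneg x))
      rw [← hm.2]
      exact H.le_of_abs_le (by rwa [abs_of_nonneg hm.1])
    · intro hx h0
      exact absurd (csInf_le hbd (show |x| ∈ Z from ⟨abs_nonneg x, by rw [H.apply_abs, h0]⟩))
        (not_le.2 hx)

end BellMinimizer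

/-- The right-hand side `2 (ω - c φ ^ (p / 2 - 1))` of the Euler-Lagrange equation `φ'' = ⋯`. -/
noncomputable def force (p ω : ℝ) (φ g : ℝ → ℝ) (x : ℝ) : ℝ :=
  2 * (ω - lagrange ω φ g * φ x ^ (p / 2 - 1))

/-- The primitive of `force` vanishing at `0`, which is the derivative of `φ` on the positivity
set; unlike `deriv φ`, it is of class `C¹` on the whole line. -/
noncomputable def phiDeriv (p ω : ℝ) (φ g : ℝ → ℝ) (x : ℝ) : ℝ := ∫ t in 0..x, force p ω φ g t

namespace BellMinimizer

variable {p ω L : ℝ} {φ g : ℝ → ℝ}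

theorem continuous_force (H : BellMinimizer p ω φ g) : Continuous (force p ω φ g) :=
  continuous_const.mul (continuous_const.sub (continuous_const.mul H.continuous_rpow_sub_one))

theorem hasDerivAt_phiDeriv (H : BellMinimizer p ω φ g) (x : ℝ) :
    HasDerivAt (phiDeriv p ω φ g) (force p ω φ g x) x :=
  intervalIntegral.integral_hasDerivAt_right (H.continuous_force.intervalIntegrable _ _)
    (H.continuous_force.stronglyMeasurableAtFilter _ _) H.continuous_force.continuousAt

theorem continuous_phiDeriv (H : BellMinimizer p ω φ g) : Continuous (phiDeriv p ω φ g) :=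
  continuous_iff_continuousAt.2 fun x => (H.hasDerivAt_phiDeriv x).continuousAt

theorem pos_of_mem (H : BellMinimizer p ω φ g) (hL : Function.support φ = Ioo (-L) L) {x : ℝ}
    (hx : x ∈ Ioo (-L) L) : 0 < φ x :=
  lt_of_le_of_ne (H.nonneg x) (Ne.symm (hL ▸ hx : x ∈ Function.support φ))

theorem apply_eq_zero (hL : Function.support φ = Ioo (-L) L) {x : ℝ} (hx : x ∉ Ioo (-L) L) :
    φ x = 0 := by
  by_contra h
  exact hx (hL ▸ h)

/-- On its positivity set the minimizer is a classical solution of the Euler-Lagrange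
equation. -/
theorem hasDerivAt (H : BellMinimizer p ω φ g) (hL : Function.support φ = Ioo (-L) L) {x : ℝ}
    (hx : x ∈ Ioo (-L) L) : HasDerivAt φ (phiDeriv p ω φ g x) x := by
  have hL0 : (0 : ℝ) ∈ Ioo (-L) L := ⟨by linarith [hx.1, hx.2], by linarith [hx.1, hx.2]⟩
  obtain ⟨F, d, h1, -, h2⟩ := exists_primitive_of_weak_second_deriv hL0
    (H.cont.continuousOn.locallyIntegrableOn measurableSet_Ioo)
    (H.continuous_force.continuousOn.locallyIntegrableOn measurableSet_Ioo) (f := φ)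
    (h := force p ω φ g) (by
      intro η e1 e2 e3
      have fv := H.first_variation (e1.of_le one_le_infty) e2 (hL ▸ e3)
      have wd := H.adm.weakDeriv.integral_eq _ (contDiff_infty_iff_deriv.1 e1).2 e2.deriv
      have i1 : Integrable fun x => φ x ^ (p / 2 - 1) * η x :=
        (H.continuous_rpow_sub_one.mul e1.continuous).integrable_of_hasCompactSupport e2.mul_left
      have i2 := e1.continuous.integrable_of_hasCompactSupport (μ := volume) e2
      have e : ∀ x, force p ω φ g x * η x
          = 2 * ω * η x - 2 * lagrange ω φ g * (φ x ^ (p / 2 - 1) * η x) := fun x => by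
        unfold force
        ring
      simp_rw [e]
      rw [integral_sub (i2.const_mul _) (i1.const_mul _), integral_const_mul, integral_const_mul]
      linarith)
  have hFφ : EqOn φ F (Ioo (-L) L) := by
    refine Measure.eqOn_open_of_ae_eq (μ := volume) ?_ isOpen_Ioo H.cont.continuousOn
      fun y hy => (h2 y hy).continuousAt.continuousWithinAt
    rw [EventuallyEq, ae_restrict_iff' measurableSet_Ioo]
    exact h1
  have hd : ∀ y ∈ Ioo (-L) L, HasDerivAt φ (d + phiDeriv p ω φ g y) y := fun y hy =>
    (h2 y hy).congr_of_eventuallyEq (hFφ.eventuallyEq_of_mem (isOpen_Ioo.mem_nhds hy))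
  have hmax : IsLocalMax φ 0 := Eventually.of_forall fun y => H.le_of_abs_le (by simp)
  -- evenness and monotonicity put the maximum at `0`, which fixes the constant of integration
  have h0 := hmax.hasDerivAt_eq_zero (hd 0 hL0)
  have : d = 0 := by simpa [phiDeriv] using h0
  simpa [this] using hd x hx

theorem ae_eq_phiDeriv (H : BellMinimizer p ω φ g) (hL : Function.support φ = Ioo (-L) L) :
    g =ᵐ[volume] (Ioo (-L) L).indicator (phiDeriv p ω φ g) := by
  have hli := H.adm.weakDeriv.locInt_deriv
  have h1 := isOpen_Ioo.ae_eq_zero_of_integral_contDiff_smul_eq_zero (μ := volume)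
    (f := fun x => g x - phiDeriv p ω φ g x) (U := Ioo (-L) L)
    ((hli.sub H.continuous_phiDeriv.locallyIntegrable).locallyIntegrableOn _) (by
      intro η e1 e2 e3
      have a := integral_deriv_mul_eq_neg (fun x hx => H.hasDerivAt hL hx)
        H.continuous_phiDeriv.continuousOn (e1.of_le one_le_infty) e2 e3
      have b := H.adm.weakDeriv.integral_eq _ e1 e2
      have i1 := integrable_mul_of_locallyIntegrableOn (hli.locallyIntegrableOn _) e1.continuous
        e2 e3
      have i2 : Integrable fun x => phiDeriv p ω φ g x * η x :=
        (H.continuous_phiDeriv.mul e1.continuous).integrable_of_hasCompactSupport e2.mul_left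
      have e : ∀ x, η x • (g x - phiDeriv p ω φ g x) = g x * η x - phiDeriv p ω φ g x * η x :=
        fun x => by simp; ring
      simp_rw [e]
      rw [integral_sub i1 i2]
      linarith)
  have h2 := (isClosed_Icc (a := -L) (b := L)).isOpen_compl
    |>.ae_eq_zero_of_integral_contDiff_smul_eq_zero (μ := volume) (f := g)
    (hli.locallyIntegrableOn _) (by
      intro η e1 e2 e3
      have b := H.adm.weakDeriv.integral_eq _ e1 e2
      have e : ∀ x, φ x * deriv η x = 0 := fun x => by
        by_cases hx : x ∈ tsupport η
        · rw [apply_eq_zero hL fun h => e3 hx (Ioo_subset_Icc_self h), zero_mul]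
        · rw [deriv_eq_zero_of_notMem_tsupport hx, mul_zero]
      simp only [e, integral_zero] at b
      simp_rw [smul_eq_mul, mul_comm (η _)]
      linarith)
  have h3 : ∀ᵐ x : ℝ, x ≠ -L := by simp [ae_iff]
  have h4 : ∀ᵐ x : ℝ, x ≠ L := by simp [ae_iff]
  filter_upwards [h1, h2, h3, h4] with x a b c d
  by_cases hx : x ∈ Ioo (-L) L
  · rw [indicator_of_mem hx]
    linarith [a hx]
  · rw [indicator_of_notMem hx]
    refine b fun h => hx ⟨lt_of_le_of_ne h.1 (Ne.symm c), lt_of_le_of_ne h.2 d⟩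

theorem phiDeriv_nonpos (H : BellMinimizer p ω φ g) (hL : Function.support φ = Ioo (-L) L) {x : ℝ}
    (hx : x ∈ Ioo 0 L) : phiDeriv p ω φ g x ≤ 0 := by
  have hd := H.hasDerivAt hL (x := x) ⟨by linarith [hx.1, hx.2], hx.2⟩
  refine le_of_tendsto ((hasDerivAt_iff_tendsto_slope.1 hd).mono_left
    (nhdsWithin_mono x fun y (hy : y ∈ Ioi x) => (ne_of_gt hy : y ≠ x))) ?_
  filter_upwards [self_mem_nhdsWithin] with y hy
  have hy : x < y := hy
  rw [slope_def_field]
  exact div_nonpos_of_nonpos_of_nonneg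
    (sub_nonpos.2 (H.bell.anti hx.1 (hx.1.trans hy) hy.le)) (by linarith)

/-- The slope of the minimizer vanishes at the edge of its support: there is no corner, since a
nonnegative perturbation concentrated at the edge would lower the energy. -/
theorem phiDeriv_edge (H : BellMinimizer p ω φ g) (hL : Function.support φ = Ioo (-L) L)
    (hL0 : 0 < L) : phiDeriv p ω φ g L = 0 := by
  refine le_antisymm ?_ ?_
  · have ht : Tendsto (phiDeriv p ω φ g) (𝓝[<] L) (𝓝 (phiDeriv p ω φ g L)) :=
      (H.continuous_phiDeriv.tendsto L).mono_left nhdsWithin_le_nhds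
    refine le_of_tendsto ht ?_
    filter_upwards [Ioo_mem_nhdsLT hL0] with x hx using H.phiDeriv_nonpos hL hx
  · -- a bump of height `1` and radius `δ` at the edge costs at most `2 ω δ` of mass
    have key : ∀ δ ∈ Ioo 0 L, 0 ≤ phiDeriv p ω φ g L + 4 * ω * δ := by
      intro δ hδ
      let f : ContDiffBump L := ⟨δ / 2, δ, by linarith [hδ.1], by linarith [hδ.1]⟩
      set η : ℝ → ℝ := ⇑f with hη
      have hηs : ContDiff ℝ 1 η := f.contDiff
      have hηc : HasCompactSupport η := f.hasCompactSupport
      have hη0 : ∀ x, 0 ≤ η x := fun x => f.nonneg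
      have hηL : η L = 1 := f.one_of_mem_closedBall (Metric.mem_closedBall_self (by
        simp only [f]; linarith [hδ.1]))
      have hηL' : η (-L) = 0 := f.zero_of_le_dist (by
        simp only [f]
        rw [Real.dist_eq, abs_of_nonpos (by linarith)]
        linarith [hδ.2])
      have hi := hηs.continuous.integrable_of_hasCompactSupport (μ := volume) hηc
      have hint : ∫ x, η x ≤ 2 * δ := by
        have := f.integral_le_measure_closedBall (μ := volume)
        rw [Real.closedBall_eq_Icc, measureReal_def, Real.volume_Icc,
          ENNReal.toReal_ofReal (by simp only [f]; linarith [hδ.1])] at this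
        simp only [f] at this
        linarith
      have fv := H.first_variation_le hηs hηc (by
        filter_upwards [self_mem_nhdsWithin] with ε (hε : 0 < ε) x
        exact add_nonneg (H.nonneg x) (mul_nonneg hε.le (hη0 x)))
      have hg : ∫ x, g x * deriv η x = ∫ x in (-L)..L, phiDeriv p ω φ g x * deriv η x := by
        rw [intervalIntegral.integral_of_le (by linarith), integral_Ioc_eq_integral_Ioo,
          ← integral_indicator measurableSet_Ioo]
        refine integral_congr_ae ?_
        filter_upwards [H.ae_eq_phiDeriv hL] with x hx
        rw [hx]
        by_cases h : x ∈ Ioo (-L) L <;> simp [h]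
      have hη' : Continuous (deriv η) := hηs.continuous_deriv le_rfl
      rw [hg, intervalIntegral.integral_mul_deriv_eq_deriv_mul
        (fun x _ => H.hasDerivAt_phiDeriv x)
        (fun x _ => (hηs.differentiable one_ne_zero x).hasDerivAt)
        (H.continuous_force.intervalIntegrable _ _) (hη'.intervalIntegrable _ _),
        hηL, hηL'] at fv
      have hφ : ∫ x, φ x ^ (p / 2 - 1) * η x = ∫ x in (-L)..L, φ x ^ (p / 2 - 1) * η x := by
        refine (intervalIntegral.integral_eq_integral_of_support_subset fun x hx => ?_).symm
        refine Ioo_subset_Ioc_self ?_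
        by_contra hn
        exact hx (by simp [apply_eq_zero hL hn,
          Real.zero_rpow (show p / 2 - 1 ≠ 0 by linarith [H.one_lt_half])])
      have e : ∀ x, force p ω φ g x * η x
          = 2 * ω * η x - 2 * lagrange ω φ g * (φ x ^ (p / 2 - 1) * η x) := fun x => by
        unfold force
        ring
      simp_rw [e] at fv
      have i1 : IntervalIntegrable (fun x => 2 * ω * η x) volume (-L) L :=
        (continuous_const.mul hηs.continuous).intervalIntegrable _ _
      have i2 : IntervalIntegrable (fun x => 2 * lagrange ω φ g * (φ x ^ (p / 2 - 1) * η x))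
          volume (-L) L :=
        (continuous_const.mul (H.continuous_rpow_sub_one.mul hηs.continuous)).intervalIntegrable
          _ _
      rw [intervalIntegral.integral_sub i1 i2, intervalIntegral.integral_const_mul,
        intervalIntegral.integral_const_mul, ← hφ] at fv
      have hpos : 0 ≤ ∫ x in (-L)..L, η x :=
        intervalIntegral.integral_nonneg (by linarith) fun x _ => hη0 x
      have l1 := mul_le_mul_of_nonneg_left hint H.ω_pos.le
      have l2 := mul_nonneg H.ω_pos.le hpos
      linarith
    have ht : Tendsto (fun δ => phiDeriv p ω φ g L + 4 * ω * δ) (𝓝[>] 0)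
        (𝓝 (phiDeriv p ω φ g L + 4 * ω * 0)) :=
      (Continuous.tendsto (by fun_prop) 0).mono_left nhdsWithin_le_nhds
    have := ge_of_tendsto ht (by filter_upwards [Ioo_mem_nhdsGT hL0] with δ hδ using key δ hδ)
    simpa using this

/-- Conservation of energy for the Euler-Lagrange equation. -/
theorem phiDeriv_sq (H : BellMinimizer p ω φ g) (hL : Function.support φ = Ioo (-L) L)
    {x : ℝ} (hx : x ∈ Ioo (-L) L) :
    phiDeriv p ω φ g x ^ 2 = 4 * ω * φ x - 8 * lagrange ω φ g / p * φ x ^ (p / 2) := by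
  have hq := H.one_lt_half
  have hL0 : 0 < L := by linarith [hx.1, hx.2]
  set E : ℝ → ℝ := fun x => phiDeriv p ω φ g x ^ 2
    - (4 * ω * φ x - 8 * lagrange ω φ g / p * φ x ^ (p / 2)) with hE
  have hEc : Continuous E :=
    (H.continuous_phiDeriv.pow 2).sub ((continuous_const.mul H.cont).sub
      (continuous_const.mul (H.cont.rpow_const fun _ => Or.inr (by linarith))))
  have hEd : ∀ y ∈ Ico x L, HasDerivWithinAt E 0 (Ici y) y := by
    intro y hy
    have hy' : y ∈ Ioo (-L) L := ⟨hx.1.trans_le hy.1, hy.2⟩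
    have d1 := H.hasDerivAt hL hy'
    have d2 := ((H.hasDerivAt_phiDeriv y).pow 2).sub ((d1.const_mul (4 * ω)).sub
      ((d1.rpow_const (p := p / 2) (Or.inr hq.le)).const_mul (8 * lagrange ω φ g / p)))
    refine HasDerivAt.hasDerivWithinAt ?_
    convert! d2 using 1
    have hp : p ≠ 0 := by linarith
    unfold force
    field_simp
    ring
  have := constant_of_has_deriv_right_zero hEc.continuousOn hEd L ⟨hx.2.le, le_rfl⟩
  have hEL : E L = 0 := by
    simp [hE, H.phiDeriv_edge hL hL0, apply_eq_zero hL (x := L) (by simp),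
      Real.zero_rpow (show p / 2 ≠ 0 by linarith)]
  rw [hEL] at this
  simp only [hE] at this
  linarith

theorem lagrange_nonneg (H : BellMinimizer p ω φ g) : 0 ≤ lagrange ω φ g :=
  add_nonneg (mul_nonneg (by norm_num) (integral_nonneg fun _ => sq_nonneg _))
    (mul_nonneg H.ω_pos.le (integral_nonneg H.nonneg))

theorem phiDeriv_sq_le (H : BellMinimizer p ω φ g) (hL : Function.support φ = Ioo (-L) L)
    {x : ℝ} (hx : x ∈ Ioo (-L) L) : phiDeriv p ω φ g x ^ 2 ≤ 4 * ω * φ x := by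
  rw [H.phiDeriv_sq hL hx]
  have := mul_nonneg (div_nonneg (mul_nonneg (by norm_num : (0 : ℝ) ≤ 8) H.lagrange_nonneg)
    (by linarith [H.two_lt] : 0 ≤ p)) (Real.rpow_nonneg (H.nonneg x) (p / 2))
  linarith

/-- Bootstrapping the Euler-Lagrange equation: `φ` is smooth where it is positive. -/
theorem contDiffOn (H : BellMinimizer p ω φ g) (hL : Function.support φ = Ioo (-L) L) :
    ContDiffOn ℝ (⊤ : ℕ∞) φ (Ioo (-L) L) := by
  rw [contDiffOn_infty]
  intro n
  induction n with
  | zero => exact contDiffOn_zero.2 H.cont.continuousOn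
  | succ n ih =>
    have hD : EqOn (deriv φ) (phiDeriv p ω φ g) (Ioo (-L) L) := fun x hx =>
      (H.hasDerivAt hL hx).deriv
    have hD' : deriv (phiDeriv p ω φ g) = force p ω φ g :=
      funext fun x => (H.hasDerivAt_phiDeriv x).deriv
    have hf : ContDiffOn ℝ n (force p ω φ g) (Ioo (-L) L) :=
      contDiffOn_const.mul (contDiffOn_const.sub (contDiffOn_const.mul
        (ih.rpow_const_of_ne fun x hx => (H.pos_of_mem hL hx).ne')))
    have hDn : ContDiffOn ℝ (n + 1) (phiDeriv p ω φ g) (Ioo (-L) L) := by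
      rw [contDiffOn_succ_iff_deriv_of_isOpen isOpen_Ioo, hD']
      exact ⟨fun x _ => (H.hasDerivAt_phiDeriv x).differentiableAt.differentiableWithinAt,
        by simp, hf⟩
    push_cast
    rw [contDiffOn_succ_iff_deriv_of_isOpen isOpen_Ioo]
    refine ⟨fun x hx => (H.hasDerivAt hL hx).differentiableAt.differentiableWithinAt, by simp, ?_⟩
    exact (hDn.of_le (by exact_mod_cast Nat.le_succ n)).congr hD

end BellMinimizer

/-! ### The function `Φ` and the operator `𝓛₊` on test functions -/

theorem ae_mem_Ioo_or_notMem_Icc (a b : ℝ) : ∀ᵐ x : ℝ, x ∈ Ioo a b ∨ x ∉ Icc a b := by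
  have h3 : ∀ᵐ x : ℝ, x ≠ a := by simp [ae_iff]
  have h4 : ∀ᵐ x : ℝ, x ≠ b := by simp [ae_iff]
  filter_upwards [h3, h4] with x c d
  by_cases hx : x ∈ Icc a b
  · exact Or.inl ⟨lt_of_le_of_ne hx.1 (Ne.symm c), lt_of_le_of_ne hx.2 d⟩
  · exact Or.inr hx

theorem IsTest.contDiff_deriv {f : ℝ → ℂ} (hf : IsTest f) : ContDiff ℝ (⊤ : ℕ∞) (deriv f) :=
  (contDiff_infty_iff_deriv.1 hf.1).2

theorem IsTest.hasDerivAt {f : ℝ → ℂ} (hf : IsTest f) (x : ℝ) : HasDerivAt f (deriv f x) x :=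
  (hf.1.differentiable (by simp) x).hasDerivAt

theorem IsTest.hasDerivAt_deriv {f : ℝ → ℂ} (hf : IsTest f) (x : ℝ) :
    HasDerivAt (deriv f) (deriv (deriv f) x) x :=
  (hf.contDiff_deriv.differentiable (by simp) x).hasDerivAt

theorem IsTest.memLp {f : ℝ → ℂ} (hf : IsTest f) : MemLp f 2 :=
  hf.1.continuous.memLp_of_hasCompactSupport hf.2

/-- The expression for `𝓛₊` on the positivity set after all derivatives of `Φ` have been
eliminated with the Euler-Lagrange equation and the conservation of energy; its coefficients are
continuous up to the edge. -/
noncomputable def innerExpr (p ω : ℝ) (φ g : ℝ → ℝ) (f : ℝ → ℂ) (x : ℝ) : ℂ :=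
  -((phiDeriv p ω φ g x : ℂ) * deriv f x + (φ x : ℂ) * deriv (deriv f) x)
    + ((lagrange ω φ g * (3 - 2 / p - p) * φ x ^ (p / 2 - 1) : ℝ) : ℂ) * f x

namespace BellMinimizer

variable {p ω L : ℝ} {φ g Φ : ℝ → ℝ}

section Sqrt

theorem sqrt_sq (H : BellMinimizer p ω φ g) (hΦ : ∀ x, Φ x = √(φ x)) (x : ℝ) :
    Φ x ^ 2 = φ x := by
  rw [hΦ, Real.sq_sqrt (H.nonneg x)]

theorem continuous_sqrt (H : BellMinimizer p ω φ g) (hΦ : ∀ x, Φ x = √(φ x)) : Continuous Φ := by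
  rw [show Φ = fun x => √(φ x) from funext hΦ]
  exact H.cont.sqrt

theorem sqrt_pos (H : BellMinimizer p ω φ g) (hL : Function.support φ = Ioo (-L) L)
    (hΦ : ∀ x, Φ x = √(φ x)) {x : ℝ} (hx : x ∈ Ioo (-L) L) : 0 < Φ x := by
  rw [hΦ]
  exact Real.sqrt_pos.2 (H.pos_of_mem hL hx)

theorem sqrt_eq_zero (hL : Function.support φ = Ioo (-L) L)
    (hΦ : ∀ x, Φ x = √(φ x)) {x : ℝ} (hx : x ∉ Ioo (-L) L) : Φ x = 0 := by
  rw [hΦ, apply_eq_zero hL hx, Real.sqrt_zero]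

theorem sqrt_rpow (H : BellMinimizer p ω φ g) (hΦ : ∀ x, Φ x = √(φ x)) (r x : ℝ) :
    Φ x ^ r = φ x ^ (r / 2) := by
  rw [hΦ, Real.sqrt_eq_rpow, ← Real.rpow_mul (H.nonneg x)]
  congr 1
  ring

theorem sqrt_rpow_sub_two (H : BellMinimizer p ω φ g) (hΦ : ∀ x, Φ x = √(φ x)) (x : ℝ) :
    Φ x ^ (p - 2) = φ x ^ (p / 2 - 1) := by
  rw [H.sqrt_rpow hΦ]
  congr 1
  ring

theorem hasDerivAt_sqrt (H : BellMinimizer p ω φ g) (hL : Function.support φ = Ioo (-L) L)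
    (hΦ : ∀ x, Φ x = √(φ x)) {x : ℝ} (hx : x ∈ Ioo (-L) L) :
    HasDerivAt Φ (phiDeriv p ω φ g x / (2 * Φ x)) x := by
  have := (H.hasDerivAt hL hx).sqrt (H.pos_of_mem hL hx).ne'
  rw [← hΦ] at this
  exact this.congr_of_eventuallyEq (Eventually.of_forall hΦ)

theorem contDiffOn_sqrt (H : BellMinimizer p ω φ g) (hL : Function.support φ = Ioo (-L) L)
    (hΦ : ∀ x, Φ x = √(φ x)) : ContDiffOn ℝ (⊤ : ℕ∞) Φ (Ioo (-L) L) := by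
  rw [show Φ = fun x => √(φ x) from funext hΦ]
  exact (H.contDiffOn hL).sqrt fun x hx => (H.pos_of_mem hL hx).ne'

theorem sqrt_mul_deriv (H : BellMinimizer p ω φ g) (hL : Function.support φ = Ioo (-L) L)
    (hΦ : ∀ x, Φ x = √(φ x)) {x : ℝ} (hx : x ∈ Ioo (-L) L) :
    Φ x * deriv Φ x = phiDeriv p ω φ g x / 2 := by
  rw [(H.hasDerivAt_sqrt hL hΦ hx).deriv]
  have := (H.sqrt_pos hL hΦ hx).ne'
  field_simp

theorem deriv_sqrt_mul_deriv (H : BellMinimizer p ω φ g) (hL : Function.support φ = Ioo (-L) L)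
    (hΦ : ∀ x, Φ x = √(φ x)) {x : ℝ} (hx : x ∈ Ioo (-L) L) :
    deriv (fun y => Φ y * deriv Φ y) x = ω - lagrange ω φ g * φ x ^ (p / 2 - 1) := by
  have he : (fun y => Φ y * deriv Φ y) =ᶠ[𝓝 x] fun y => phiDeriv p ω φ g y / 2 := by
    filter_upwards [isOpen_Ioo.mem_nhds hx] with y hy using H.sqrt_mul_deriv hL hΦ hy
  rw [he.deriv_eq, ((H.hasDerivAt_phiDeriv x).div_const 2).deriv]
  unfold force
  ring

theorem multiplier_eq (H : BellMinimizer p ω φ g) (hL : Function.support φ = Ioo (-L) L)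
    (hΦ : ∀ x, Φ x = √(φ x)) : multiplier ω Φ = lagrange ω φ g := by
  have h1 : ∫ x, (Φ x * deriv Φ x) ^ 2 = ∫ x, (1 / 4) * g x ^ 2 := by
    refine integral_congr_ae ?_
    filter_upwards [H.ae_eq_phiDeriv hL] with x hx
    rw [hx]
    by_cases h : x ∈ Ioo (-L) L
    · rw [indicator_of_mem h, H.sqrt_mul_deriv hL hΦ h]
      ring
    · rw [indicator_of_notMem h, sqrt_eq_zero hL hΦ h]
      ring
  unfold multiplier lagrange
  simp_rw [H.sqrt_sq hΦ]
  rw [h1, integral_const_mul]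
  ring

theorem bellShaped_sqrt (H : BellMinimizer p ω φ g) (hΦ : ∀ x, Φ x = √(φ x)) : BellShaped Φ where
  even x := by rw [hΦ, hΦ, H.bell.even]
  nonneg x := by rw [hΦ]; exact Real.sqrt_nonneg _
  anti x hx y hy hxy := by
    rw [hΦ, hΦ]
    exact Real.sqrt_le_sqrt (H.bell.anti hx hy hxy)

/-- The substitution `v = u²` identifies the two minimization problems. -/
theorem isMinimizerU_sqrt (H : BellMinimizer p ω φ g) (hΦ : ∀ x, Φ x = √(φ x)) :
    IsMinimizerU p ω Φ := by
  have hp := H.two_lt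
  have hrp : ∀ a : ℝ, |a ^ 2| ^ (p / 2) = |a| ^ p := fun a => by
    rw [abs_pow, ← Real.rpow_natCast, ← Real.rpow_mul (abs_nonneg a)]
    congr 1
    push_cast
    ring
  have hwd := H.adm.weakDeriv.const_mul (1 / 2)
  refine ⟨fun x => 1 / 2 * g x, ⟨?_, ?_, H.adm.memL2_deriv.const_mul _, ?_, ?_⟩, fun w k hw => ?_⟩
  · rw [memLp_two_iff_integrable_sq (H.continuous_sqrt hΦ).aestronglyMeasurable]
    simp_rw [H.sqrt_sq hΦ]
    exact H.adm.integrable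
  · simp_rw [H.sqrt_sq hΦ]
    exact H.adm.memL2
  · have e : (fun x => Φ x ^ 2 / 2) = fun x => 1 / 2 * φ x := funext fun x => by
      rw [H.sqrt_sq hΦ]; ring
    rwa [e]
  · simp_rw [← hrp, H.sqrt_sq hΦ]
    exact H.adm.constraint
  · have adm : AdmissibleV p (fun x => w x ^ 2) (fun x => 2 * k x) :=
      { integrable := hw.memL2.integrable_sq
        memL2 := hw.memL2_sq
        memL2_deriv := hw.memL2_deriv.const_mul 2
        weakDeriv := by
          have := hw.weakDeriv.const_mul 2
          have e : (fun x => 2 * (w x ^ 2 / 2)) = fun x => w x ^ 2 := funext fun x => by ring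
          rwa [e] at this
        constraint := by
          simp_rw [hrp]
          exact hw.constraint }
    have hmin := H.minimal _ _ adm
    unfold energyV at hmin
    unfold energyU
    simp_rw [sq_abs, H.sqrt_sq hΦ, mul_pow, integral_const_mul] at hmin ⊢
    have hw2 : ∀ x, |w x ^ 2| = w x ^ 2 := fun x => abs_of_nonneg (sq_nonneg _)
    simp_rw [abs_of_nonneg (H.nonneg _), hw2] at hmin
    linarith

theorem euler_lagrange_sqrt (H : BellMinimizer p ω φ g) (hL : Function.support φ = Ioo (-L) L)
    (hΦ : ∀ x, Φ x = √(φ x)) {x : ℝ} (hx : x ∈ Ioo (-L) L) :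
    -Φ x * deriv (fun y => Φ y * deriv Φ y) x + ω * Φ x
          - multiplier ω Φ * Φ x ^ (p - 1) = 0 := by
  rw [H.deriv_sqrt_mul_deriv hL hΦ hx, H.multiplier_eq hL hΦ,
    show p - 1 = (p - 2) + 1 by ring, Real.rpow_add_one (H.sqrt_pos hL hΦ hx).ne',
    H.sqrt_rpow_sub_two hΦ]
  ring

end Sqrt

section Lplus

variable {f : ℝ → ℂ}

theorem Lplus_eq (H : BellMinimizer p ω φ g) (hL : Function.support φ = Ioo (-L) L)
    (hΦ : ∀ x, Φ x = √(φ x)) (f : ℝ → ℂ) {x : ℝ} (hx : x ∈ Ioo (-L) L) :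
    Lplus p ω Φ f x = -(Φ x : ℂ) * deriv (deriv fun y => (Φ y : ℂ) * f y) x
      - (((p - 2) * lagrange ω φ g * φ x ^ (p / 2 - 1) : ℝ) : ℂ) * f x := by
  unfold Lplus
  rw [H.deriv_sqrt_mul_deriv hL hΦ hx, H.multiplier_eq hL hΦ, H.sqrt_rpow_sub_two hΦ]
  push_cast
  ring

theorem Lplus_eq_of_notMem (H : BellMinimizer p ω φ g) (hL : Function.support φ = Ioo (-L) L)
    (hΦ : ∀ x, Φ x = √(φ x)) (f : ℝ → ℂ) {x : ℝ} (hx : x ∉ Icc (-L) L) :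
    Lplus p ω Φ f x = ω * f x := by
  have hx' : x ∉ Ioo (-L) L := fun h => hx (Ioo_subset_Icc_self h)
  have he : (fun y => Φ y * deriv Φ y) =ᶠ[𝓝 x] fun _ => 0 := by
    filter_upwards [isClosed_Icc.isOpen_compl.mem_nhds hx] with y hy
    rw [sqrt_eq_zero hL hΦ fun h => hy (Ioo_subset_Icc_self h), zero_mul]
  unfold Lplus
  rw [he.deriv_eq, sqrt_eq_zero hL hΦ hx', Real.zero_rpow (by linarith [H.two_lt])]
  simp

theorem Lplus_eq_innerExpr (H : BellMinimizer p ω φ g) (hL : Function.support φ = Ioo (-L) L)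
    (hΦ : ∀ x, Φ x = √(φ x)) (hf : IsTest f) {x : ℝ} (hx : x ∈ Ioo (-L) L) :
    Lplus p ω Φ f x = innerExpr p ω φ g f x := by
  rw [H.Lplus_eq hL hΦ f hx]
  have hd1 : ∀ y ∈ Ioo (-L) L, HasDerivAt (fun y => (Φ y : ℂ) * f y)
      (((phiDeriv p ω φ g y / (2 * Φ y) : ℝ) : ℂ) * f y + (Φ y : ℂ) * deriv f y) y := fun y hy =>
    ((H.hasDerivAt_sqrt hL hΦ hy).ofReal_comp).mul (hf.hasDerivAt y)
  have he : (deriv fun y => (Φ y : ℂ) * f y) =ᶠ[𝓝 x] fun y =>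
      ((phiDeriv p ω φ g y / (2 * Φ y) : ℝ) : ℂ) * f y + (Φ y : ℂ) * deriv f y := by
    filter_upwards [isOpen_Ioo.mem_nhds hx] with y hy using (hd1 y hy).deriv
  have hpos := H.sqrt_pos hL hΦ hx
  have hs := H.hasDerivAt_sqrt hL hΦ hx
  have hd2 : HasDerivAt (fun y => ((phiDeriv p ω φ g y / (2 * Φ y) : ℝ) : ℂ) * f y
      + (Φ y : ℂ) * deriv f y) _ x := ((((H.hasDerivAt_phiDeriv x).div (hs.const_mul 2)
    (by positivity)).ofReal_comp).mul (hf.hasDerivAt x)).add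
    (hs.ofReal_comp.mul (hf.hasDerivAt_deriv x))
  rw [he.deriv_eq, hd2.deriv, Pi.div_apply]
  -- the conservation of energy evaluates `Φ Φ''`
  have hsq := H.sqrt_sq hΦ x
  have hDsq := H.phiDeriv_sq hL hx
  have hp : p ≠ 0 := by linarith [H.two_lt]
  have hφ0 := H.pos_of_mem hL hx
  have e1 : Φ x * ((force p ω φ g x * (2 * Φ x)
      - phiDeriv p ω φ g x * (2 * (phiDeriv p ω φ g x / (2 * Φ x)))) / (2 * Φ x) ^ 2)
      = -(lagrange ω φ g * (1 - 2 / p) * φ x ^ (p / 2 - 1)) := by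
    have : Φ x * ((force p ω φ g x * (2 * Φ x)
      - phiDeriv p ω φ g x * (2 * (phiDeriv p ω φ g x / (2 * Φ x)))) / (2 * Φ x) ^ 2)
      = force p ω φ g x / 2 - phiDeriv p ω φ g x ^ 2 / (4 * Φ x ^ 2) := by
      field_simp
      ring
    rw [this, hDsq, hsq, Real.rpow_sub_one hφ0.ne']
    unfold force
    rw [Real.rpow_sub_one hφ0.ne']
    field_simp
    ring
  have e2 : Φ x * (phiDeriv p ω φ g x / (2 * Φ x)) = phiDeriv p ω φ g x / 2 := by
    field_simp
  have e1' := congrArg (fun r : ℝ => (r : ℂ)) e1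
  have e2' := congrArg (fun r : ℝ => (r : ℂ)) e2
  have e3' := congrArg (fun r : ℝ => (r : ℂ)) hsq
  simp only [Complex.ofReal_mul, Complex.ofReal_pow] at e1' e2' e3'
  unfold innerExpr
  simp only [Complex.ofReal_mul, Complex.ofReal_sub, Complex.ofReal_neg] at e1' e2' ⊢
  rw [← e3']
  push_cast at e1' e2' ⊢
  linear_combination (-f x) * e1' - 2 * deriv f x * e2'

theorem continuous_innerExpr (H : BellMinimizer p ω φ g) (hf : IsTest f) :
    Continuous (innerExpr p ω φ g f) := by
  have c0 := hf.1.continuous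
  have c1 := hf.contDiff_deriv.continuous
  have c2 := (contDiff_infty_iff_deriv.1 hf.contDiff_deriv).2.continuous
  exact (((Complex.continuous_ofReal.comp H.continuous_phiDeriv).mul c1).add
    ((Complex.continuous_ofReal.comp H.cont).mul c2)).neg.add
    ((Complex.continuous_ofReal.comp (continuous_const.mul H.continuous_rpow_sub_one)).mul c0)

theorem innerExpr_eq_zero {x : ℝ} (hx : x ∉ tsupport f) : innerExpr p ω φ g f x = 0 := by
  have h1 : tsupport (deriv f) ⊆ tsupport f :=
    closure_minimal support_deriv_subset (isClosed_tsupport _)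
  simp [innerExpr, image_eq_zero_of_notMem_tsupport hx, deriv_eq_zero_of_notMem_tsupport hx,
    deriv_eq_zero_of_notMem_tsupport fun h => hx (h1 h)]

theorem Lplus_ae_eq (H : BellMinimizer p ω φ g) (hL : Function.support φ = Ioo (-L) L)
    (hΦ : ∀ x, Φ x = √(φ x)) (hf : IsTest f) :
    Lplus p ω Φ f =ᵐ[volume] fun x => (Ioo (-L) L).indicator (innerExpr p ω φ g f) x
      + (Ioo (-L) L)ᶜ.indicator (fun x => ω * f x) x := by
  filter_upwards [ae_mem_Ioo_or_notMem_Icc (-L) L] with x hx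
  rcases hx with hx | hx
  · rw [H.Lplus_eq_innerExpr hL hΦ hf hx, indicator_of_mem hx,
      indicator_of_notMem (by simpa using hx), add_zero]
  · have hx' : x ∉ Ioo (-L) L := fun h => hx (Ioo_subset_Icc_self h)
    rw [H.Lplus_eq_of_notMem hL hΦ f hx, indicator_of_notMem hx', indicator_of_mem hx', zero_add]

theorem memLp_Lplus (H : BellMinimizer p ω φ g) (hL : Function.support φ = Ioo (-L) L)
    (hΦ : ∀ x, Φ x = √(φ x)) (hf : IsTest f) : MemLp (Lplus p ω Φ f) 2 := by
  refine (memLp_congr_ae (H.Lplus_ae_eq hL hΦ hf)).2 (MemLp.add ?_ ?_)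
  · refine MemLp.indicator measurableSet_Ioo
      ((H.continuous_innerExpr hf).memLp_of_hasCompactSupport ?_)
    refine HasCompactSupport.of_support_subset_isCompact hf.2.isCompact fun x hx => ?_
    by_contra hn
    exact hx (innerExpr_eq_zero hn)
  · exact MemLp.indicator measurableSet_Ioo.compl
      ((hf.1.continuous.memLp_of_hasCompactSupport hf.2).const_mul _)

/-- `𝓛₊` is symmetric on test functions: the Wronskian `φ (f' h̄ - f h̄')` vanishes at the edge. -/
theorem symmetric_Lplus (H : BellMinimizer p ω φ g) (hL : Function.support φ = Ioo (-L) L)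
    (hL0 : 0 < L) (hΦ : ∀ x, Φ x = √(φ x)) {h : ℝ → ℂ} (hf : IsTest f) (hh : IsTest h) :
    ∫ x, Lplus p ω Φ f x * (starRingEnd ℂ) (h x)
      = ∫ x, f x * (starRingEnd ℂ) (Lplus p ω Φ h x) := by
  have i1 : Integrable fun x => Lplus p ω Φ f x * (starRingEnd ℂ) (h x) :=
    (H.memLp_Lplus hL hΦ hf).integrable_mul hh.memLp.star
  have i2 : Integrable fun x => f x * (starRingEnd ℂ) (Lplus p ω Φ h x) :=
    hf.memLp.integrable_mul (H.memLp_Lplus hL hΦ hh).star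
  rw [← sub_eq_zero, ← integral_sub i1 i2]
  set W : ℝ → ℂ := fun x => (φ x : ℂ) *
    (deriv f x * star (h x) - f x * star (deriv h x)) with hW
  set W' : ℝ → ℂ := fun x => (phiDeriv p ω φ g x : ℂ) *
    (deriv f x * star (h x) - f x * star (deriv h x)) + (φ x : ℂ) *
    (deriv (deriv f) x * star (h x) - f x * star (deriv (deriv h) x)) with hW'
  have cf0 := hf.1.continuous
  have cf1 := hf.contDiff_deriv.continuous
  have cf2 := (contDiff_infty_iff_deriv.1 hf.contDiff_deriv).2.continuous
  have ch0 := hh.1.continuous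
  have ch1 := hh.contDiff_deriv.continuous
  have ch2 := (contDiff_infty_iff_deriv.1 hh.contDiff_deriv).2.continuous
  have cφ := Complex.continuous_ofReal.comp H.cont
  have cD := Complex.continuous_ofReal.comp H.continuous_phiDeriv
  have hWc : Continuous W := cφ.mul ((cf1.mul ch0.star).sub (cf0.mul ch1.star))
  have hWc' : Continuous W' := (cD.mul ((cf1.mul ch0.star).sub (cf0.mul ch1.star))).add
    (cφ.mul ((cf2.mul ch0.star).sub (cf0.mul ch2.star)))
  have hWd : ∀ x ∈ Ioo (-L) L, HasDerivAt W (W' x) x := by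
    intro x hx
    have := (H.hasDerivAt hL hx).ofReal_comp.mul
      (((hf.hasDerivAt_deriv x).mul (hh.hasDerivAt x).star).sub
      ((hf.hasDerivAt x).mul (hh.hasDerivAt_deriv x).star))
    convert! this using 1
    simp only [hW', Pi.sub_apply, Pi.mul_apply]
    ring
  have hFTC := intervalIntegral.integral_eq_sub_of_hasDerivAt_of_le (by linarith : -L ≤ L)
    hWc.continuousOn hWd (hWc'.intervalIntegrable _ _)
  have hWL : W L = 0 := by simp [hW, apply_eq_zero hL (x := L) (by simp)]
  have hWL' : W (-L) = 0 := by simp [hW, apply_eq_zero hL (x := -L) (by simp)]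
  rw [hWL, hWL', sub_zero, intervalIntegral.integral_of_le (by linarith),
    integral_Ioc_eq_integral_Ioo, ← integral_indicator measurableSet_Ioo] at hFTC
  rw [← neg_eq_zero, ← integral_neg, ← hFTC]
  refine integral_congr_ae ?_
  filter_upwards [H.Lplus_ae_eq hL hΦ hf, H.Lplus_ae_eq hL hΦ hh] with x e1 e2
  rw [e1, e2]
  by_cases hx : x ∈ Ioo (-L) L
  · have hx' : x ∉ (Ioo (-L) L)ᶜ := by simpa using hx
    simp only [indicator_of_mem hx, indicator_of_notMem hx', add_zero, innerExpr, hW', map_add,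
      map_neg, map_mul, Complex.conj_ofReal]
    simp only [starRingEnd_apply]
    ring
  · have hx' : x ∈ (Ioo (-L) L)ᶜ := hx
    simp only [indicator_of_mem hx', indicator_of_notMem hx, zero_add, map_mul,
      Complex.conj_ofReal]
    ring

end Lplus

end BellMinimizer

/-! ### Nonnegativity of the quadratic form under a weak equation -/

theorem exists_bound_deriv_smoothTransition :
    ∃ C : ℝ, ∀ x, |deriv Real.smoothTransition x| ≤ C := by
  have hc : Continuous (deriv Real.smoothTransition) :=
    (Real.smoothTransition.contDiff (n := 1)).continuous_deriv le_rfl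
  have hs : HasCompactSupport (deriv Real.smoothTransition) := by
    refine HasCompactSupport.of_support_subset_isCompact (isCompact_Icc (a := 0) (b := 1))
      fun x hx => ?_
    by_contra hn
    refine hx ?_
    rw [mem_Icc, not_and_or, not_le, not_le] at hn
    rcases hn with hn | hn
    · have : Real.smoothTransition =ᶠ[𝓝 x] fun _ => 0 := by
        filter_upwards [gt_mem_nhds hn] with y hy using Real.smoothTransition.zero_of_nonpos hy.le
      rw [this.deriv_eq, deriv_const]
    · have : Real.smoothTransition =ᶠ[𝓝 x] fun _ => 1 := by
        filter_upwards [lt_mem_nhds hn] with y hy using Real.smoothTransition.one_of_one_le hy.le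
      rw [this.deriv_eq, deriv_const]
  exact hc.bounded_above_of_compact_support hs

/-- A logarithmic cutoff in the positivity set of `φ`: it vanishes where `φ ≤ exp (-2 (n + 1))`
and equals `1` where `φ ≥ exp (-(n + 1))`. -/
noncomputable def cutoff (φ : ℝ → ℝ) (n : ℕ) : ℝ → ℝ :=
  (Function.support φ).indicator fun x => Real.smoothTransition (2 + Real.log (φ x) / (n + 1))

theorem cutoff_nonneg (φ : ℝ → ℝ) (n : ℕ) (x : ℝ) : 0 ≤ cutoff φ n x :=
  indicator_nonneg (fun _ _ => Real.smoothTransition.nonneg _) x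

theorem cutoff_le_one (φ : ℝ → ℝ) (n : ℕ) (x : ℝ) : cutoff φ n x ≤ 1 :=
  indicator_le' (fun _ _ => Real.smoothTransition.le_one _) (fun _ _ => zero_le_one) x

theorem tendsto_cutoff {φ : ℝ → ℝ} {x : ℝ} (hx : x ∈ Function.support φ) :
    Tendsto (fun n => cutoff φ n x) atTop (𝓝 1) := by
  have h : Tendsto (fun n : ℕ => 2 + Real.log (φ x) / ((n : ℝ) + 1)) atTop (𝓝 (2 + 0)) :=
    tendsto_const_nhds.add (tendsto_const_nhds.div_atTop
      (tendsto_atTop_add_const_right _ _ tendsto_natCast_atTop_atTop))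
  refine tendsto_const_nhds.congr' ?_
  filter_upwards [h.eventually (lt_mem_nhds (show (1 : ℝ) < 2 + 0 by norm_num))] with n hn
  rw [cutoff, indicator_of_mem hx, Real.smoothTransition.one_of_one_le hn.le]

/-- The potential `(p - 2) c Φ ^ (p - 2)`. -/
noncomputable def potential (p ω : ℝ) (φ g : ℝ → ℝ) (x : ℝ) : ℝ :=
  (p - 2) * lagrange ω φ g * φ x ^ (p / 2 - 1)

namespace BellMinimizer

variable {p ω L : ℝ} {φ g Φ : ℝ → ℝ}

theorem tsupport_cutoff (H : BellMinimizer p ω φ g) (n : ℕ) :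
    tsupport (cutoff φ n) ⊆ {x | Real.exp (-2 * (n + 1)) ≤ φ x} := by
  refine closure_minimal (fun x hx => ?_) (isClosed_le continuous_const H.cont)
  by_contra hn
  simp only [mem_ofPred_eq, not_le] at hn
  refine hx ?_
  by_cases h0 : x ∈ Function.support φ
  · have hpos : 0 < φ x := lt_of_le_of_ne (H.nonneg x) (Ne.symm h0)
    rw [cutoff, indicator_of_mem h0]
    refine Real.smoothTransition.zero_of_nonpos ?_
    have h1 : Real.log (φ x) ≤ -2 * (n + 1) := (Real.log_le_iff_le_exp hpos).2 hn.le
    have h2 : (0 : ℝ) < n + 1 := by positivity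
    have : Real.log (φ x) / (n + 1) ≤ -2 := by rwa [div_le_iff₀ h2]
    linarith
  · rw [cutoff, indicator_of_notMem h0]

theorem tsupport_cutoff_subset (H : BellMinimizer p ω φ g)
    (hL : Function.support φ = Ioo (-L) L) (n : ℕ) : tsupport (cutoff φ n) ⊆ Ioo (-L) L :=
  fun x hx => by
    rw [← hL]
    exact ((Real.exp_pos _).trans_le (H.tsupport_cutoff n hx)).ne'

theorem hasCompactSupport_cutoff (H : BellMinimizer p ω φ g)
    (hL : Function.support φ = Ioo (-L) L) (n : ℕ) : HasCompactSupport (cutoff φ n) :=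
  isCompact_Icc.of_isClosed_subset (isClosed_tsupport _)
    ((H.tsupport_cutoff_subset hL n).trans Ioo_subset_Icc_self)

theorem hasDerivAt_cutoff (H : BellMinimizer p ω φ g) (hL : Function.support φ = Ioo (-L) L)
    (n : ℕ) {x : ℝ} (hx : x ∈ Ioo (-L) L) :
    HasDerivAt (cutoff φ n) (deriv Real.smoothTransition (2 + Real.log (φ x) / (n + 1))
      * (phiDeriv p ω φ g x / φ x / (n + 1))) x := by
  have h1 := (((H.hasDerivAt hL hx).log (H.pos_of_mem hL hx).ne').div_const
    ((n : ℝ) + 1)).const_add 2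
  have h2 := ((Real.smoothTransition.contDiff (n := 1)).differentiable one_ne_zero
    (2 + Real.log (φ x) / (n + 1))).hasDerivAt
  refine (h2.comp x h1).congr_of_eventuallyEq ?_
  filter_upwards [isOpen_Ioo.mem_nhds hx] with y hy
  rw [cutoff, indicator_of_mem (hL ▸ hy)]
  rfl

theorem contDiff_cutoff (H : BellMinimizer p ω φ g) (hL : Function.support φ = Ioo (-L) L)
    (n : ℕ) : ContDiff ℝ 1 (cutoff φ n) := by
  refine contDiff_of_contDiffAt_tsupport fun x hx => ?_
  have hx' := H.tsupport_cutoff_subset hL n hx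
  have h1 : ContDiffAt ℝ 1 φ x :=
    ((H.contDiffOn hL).contDiffAt (isOpen_Ioo.mem_nhds hx')).of_le one_le_infty
  have h2 : ContDiffAt ℝ 1
      (fun x => Real.smoothTransition (2 + Real.log (φ x) / (n + 1))) x :=
    Real.smoothTransition.contDiffAt.comp x
      (contDiffAt_const.add ((h1.log (H.pos_of_mem hL hx').ne').div_const _))
  refine h2.congr_of_eventuallyEq ?_
  filter_upwards [isOpen_Ioo.mem_nhds hx'] with y hy
  rw [cutoff, indicator_of_mem (hL ▸ hy)]

/-- The gradient of the cutoff is small compared with `φ⁻¹`, since `φ'² ≤ 4 ω φ`. -/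
theorem mul_deriv_cutoff_sq_le (H : BellMinimizer p ω φ g) (hL : Function.support φ = Ioo (-L) L)
    {C : ℝ} (hC : ∀ x, |deriv Real.smoothTransition x| ≤ C) (n : ℕ) {x : ℝ}
    (hx : x ∈ Ioo (-L) L) :
    φ x * deriv (cutoff φ n) x ^ 2 ≤ 4 * ω * C ^ 2 / ((n : ℝ) + 1) ^ 2 := by
  rw [(H.hasDerivAt_cutoff hL n hx).deriv]
  set t := deriv Real.smoothTransition (2 + Real.log (φ x) / (n + 1)) with ht
  have hpos := H.pos_of_mem hL hx
  have h1 : t ^ 2 ≤ C ^ 2 := by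
    rw [← sq_abs]
    exact pow_le_pow_left₀ (abs_nonneg _) (hC _) 2
  have h2 : phiDeriv p ω φ g x ^ 2 / φ x ≤ 4 * ω := by
    rw [div_le_iff₀ hpos]
    exact H.phiDeriv_sq_le hL hx
  have e : φ x * (t * (phiDeriv p ω φ g x / φ x / (n + 1))) ^ 2
      = (phiDeriv p ω φ g x ^ 2 / φ x) * t ^ 2 / ((n : ℝ) + 1) ^ 2 := by
    field_simp
  rw [e]
  have h3 : 0 ≤ 4 * ω := by linarith [H.ω_pos]
  gcongr

theorem continuous_potential (H : BellMinimizer p ω φ g) : Continuous (potential p ω φ g) :=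
  continuous_const.mul H.continuous_rpow_sub_one

/-- Localization of the quadratic form of `𝓛₊` with a cutoff `χ`, combined with the second
variation for the perturbation `Φ u χ`. Here `r` stands for `𝓛₊ u`, and `F` is the representative
of `Φ u` of class `C¹` provided by the equation `(Φ u)'' = -(r + potential * u) / Φ`. -/
theorem localized_form_ge (H : BellMinimizer p ω φ g) (hL : Function.support φ = Ioo (-L) L)
    (hΦ : ∀ x, Φ x = √(φ x)) {u r F χ : ℝ → ℝ} {K d : ℝ} (hu : MemLp u 2) (hr : MemLp r 2)
    (hK : ∀ ψ : ℝ → ℝ, ContDiff ℝ 1 ψ → HasCompactSupport ψ → tsupport ψ ⊆ Function.support φ →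
      0 ≤ (∫ x, deriv ψ x ^ 2)
        - (p - 2) * lagrange ω φ g * (∫ x, φ x ^ (p / 2 - 2) * ψ x ^ 2)
        + K * (∫ x, φ x ^ (p / 2 - 1) * ψ x) ^ 2
        + 4 * ω * (∫ x, φ x ^ (p / 2 - 1) * ψ x) * ∫ x, ψ x)
    (hloc : LocallyIntegrableOn (fun x => -((r x + potential p ω φ g x * u x) / Φ x)) (Ioo (-L) L))
    (hF : ∀ᵐ x, x ∈ Ioo (-L) L → Φ x * u x = F x)
    (hDc : ContinuousOn (fun x => d + ∫ t in 0..x, -((r t + potential p ω φ g t * u t) / Φ t))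
      (Ioo (-L) L))
    (hD : ∀ x ∈ Ioo (-L) L,
      HasDerivAt F (d + ∫ t in 0..x, -((r t + potential p ω φ g t * u t) / Φ t)) x)
    (hχ : ContDiff ℝ 1 χ) (hχc : HasCompactSupport χ) (hχs : tsupport χ ⊆ Ioo (-L) L) :
    0 ≤ (∫ x, r x * u x * χ x ^ 2) + (∫ x, (Φ x * u x * deriv χ x) ^ 2)
      + K * (∫ x, φ x ^ (p / 2 - 1) * (Φ x * u x * χ x)) ^ 2
      + 4 * ω * (∫ x, φ x ^ (p / 2 - 1) * (Φ x * u x * χ x)) * ∫ x, Φ x * u x * χ x := by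
  rcases (tsupport χ).eq_empty_or_nonempty with he | ⟨y, hy⟩
  · have : χ = 0 := tsupport_eq_empty_iff.1 he
    simp [this]
  have hL0 : (0 : ℝ) ∈ Ioo (-L) L := by
    have := hχs hy
    exact ⟨by linarith [this.1, this.2], by linarith [this.1, this.2]⟩
  set D : ℝ → ℝ := fun x => d + ∫ t in 0..x, -((r t + potential p ω φ g t * u t) / Φ t) with hDdef
  have hFat : ∀ x ∈ Ioo (-L) L, ContDiffAt ℝ 1 F x := by
    have : ContDiffOn ℝ 1 F (Ioo (-L) L) := by
      have h := contDiffOn_succ_iff_deriv_of_isOpen (𝕜 := ℝ) (n := 0) (f := F)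
        (isOpen_Ioo (a := -L) (b := L))
      rw [zero_add] at h
      refine h.2 ⟨fun x hx => (hD x hx).differentiableAt.differentiableWithinAt, by simp, ?_⟩
      exact contDiffOn_zero.2 (hDc.congr fun x hx => (hD x hx).deriv)
    exact fun x hx => this.contDiffAt (isOpen_Ioo.mem_nhds hx)
  have hsub : ∀ {ζ : ℝ → ℝ}, (∀ x, χ x = 0 → ζ x = 0) → tsupport ζ ⊆ tsupport χ := fun h =>
    closure_mono fun x hx hx' => hx (h x hx')
  -- the perturbation `F χ` and the multiplier `F χ²`
  have s1 : tsupport (fun x => F x * χ x) ⊆ tsupport χ := hsub fun x hx => by simp [hx]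
  have s2 : tsupport (fun x => F x * χ x ^ 2) ⊆ tsupport χ := hsub fun x hx => by simp [hx]
  have c1 : ContDiff ℝ 1 fun x => F x * χ x := contDiff_of_contDiffAt_tsupport fun x hx =>
    (hFat x (hχs (s1 hx))).mul hχ.contDiffAt
  have c2 : ContDiff ℝ 1 fun x => F x * χ x ^ 2 := contDiff_of_contDiffAt_tsupport fun x hx =>
    (hFat x (hχs (s2 hx))).mul (hχ.pow 2).contDiffAt
  have k1 : HasCompactSupport fun x => F x * χ x := hχc.of_isClosed_subset (isClosed_tsupport _) s1
  have k2 : HasCompactSupport fun x => F x * χ x ^ 2 :=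
    hχc.of_isClosed_subset (isClosed_tsupport _) s2
  have ibp := integral_mul_eq_neg_integral_primitive_mul_deriv hloc hL0 c2 k2 (s2.trans hχs) d
  have sv := hK _ c1 k1 (hL ▸ s1.trans hχs)
  -- `F' (F χ²)' = ((F χ)')² - (F χ')²`, which turns the form into that of `F χ` up to an error
  have p1 : ∀ x, D x * deriv (fun x => F x * χ x ^ 2) x
      = deriv (fun x => F x * χ x) x ^ 2 - (F x * deriv χ x) ^ 2 := by
    intro x
    by_cases hx : x ∈ tsupport χ
    · have hχd := (hχ.differentiable one_ne_zero x).hasDerivAt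
      have e1 : deriv (fun x => F x * χ x) x = D x * χ x + F x * deriv χ x :=
        ((hD x (hχs hx)).mul hχd).deriv
      have e2 : deriv (fun x => F x * χ x ^ 2) x
          = D x * χ x ^ 2 + F x * ((2 : ℕ) * χ x ^ (2 - 1) * deriv χ x) :=
        ((hD x (hχs hx)).mul (hχd.pow 2)).deriv
      rw [e1, e2]
      push_cast
      ring
    · rw [deriv_eq_zero_of_notMem_tsupport fun h => hx (s1 h),
        deriv_eq_zero_of_notMem_tsupport fun h => hx (s2 h), deriv_eq_zero_of_notMem_tsupport hx]
      ring
  have p2 : (fun x => -((r x + potential p ω φ g x * u x) / Φ x) * (F x * χ x ^ 2))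
      =ᵐ[volume] fun x => -(r x * u x * χ x ^ 2 + potential p ω φ g x * u x ^ 2 * χ x ^ 2) := by
    filter_upwards [hF] with x hx
    by_cases hxs : x ∈ tsupport χ
    · have := (H.sqrt_pos hL hΦ (hχs hxs)).ne'
      rw [← hx (hχs hxs)]
      field_simp
    · simp [image_eq_zero_of_notMem_tsupport hxs]
  have p3 : (fun x => φ x ^ (p / 2 - 2) * (F x * χ x) ^ 2)
      =ᵐ[volume] fun x => φ x ^ (p / 2 - 1) * u x ^ 2 * χ x ^ 2 := by
    filter_upwards [hF] with x hx
    by_cases hxs : x ∈ tsupport χ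
    · have h0 := H.pos_of_mem hL (hχs hxs)
      have e : φ x ^ (p / 2 - 1) = φ x ^ (p / 2 - 2) * φ x := by
        rw [← Real.rpow_add_one h0.ne']
        congr 1
        ring
      rw [← hx (hχs hxs), e, ← H.sqrt_sq hΦ x]
      ring
    · simp [image_eq_zero_of_notMem_tsupport hxs]
  have p4 : (fun x => F x * χ x) =ᵐ[volume] fun x => Φ x * u x * χ x := by
    filter_upwards [hF] with x hx
    by_cases hxs : x ∈ tsupport χ
    · rw [hx (hχs hxs)]
    · simp [image_eq_zero_of_notMem_tsupport hxs]
  have p5 : (fun x => (F x * deriv χ x) ^ 2) =ᵐ[volume] fun x => (Φ x * u x * deriv χ x) ^ 2 := by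
    filter_upwards [hF] with x hx
    by_cases hxs : x ∈ tsupport χ
    · rw [hx (hχs hxs)]
    · simp [deriv_eq_zero_of_notMem_tsupport hxs]
  have p6 : (fun x => φ x ^ (p / 2 - 1) * (F x * χ x))
      =ᵐ[volume] fun x => φ x ^ (p / 2 - 1) * (Φ x * u x * χ x) := by
    filter_upwards [p4] with x hx
    rw [hx]
  have hχ2 : Continuous fun x => χ x ^ 2 := hχ.continuous.pow 2
  have bdd : ∀ {w : ℝ → ℝ} {a : ℝ → ℝ}, Integrable w → Continuous a →
      Integrable fun x => w x * (a x * χ x ^ 2) := by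
    intro w a hw ha
    have hc : HasCompactSupport fun x => a x * χ x ^ 2 :=
      hχc.of_isClosed_subset (isClosed_tsupport _) (hsub fun x hx => by simp [hx])
    obtain ⟨B, hB⟩ := (ha.mul hχ2).bounded_above_of_compact_support hc
    exact hw.mul_bdd (ha.mul hχ2).aestronglyMeasurable (Eventually.of_forall hB)
  have i1 : Integrable fun x => r x * u x * χ x ^ 2 := by
    simpa using bdd (hr.integrable_mul hu) continuous_const (a := fun _ => 1)
  have i2 : Integrable fun x => potential p ω φ g x * u x ^ 2 * χ x ^ 2 :=
    (bdd hu.integrable_sq H.continuous_potential).congr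
      (Eventually.of_forall fun x => by ring)
  have i3 : Integrable fun x => deriv (fun x => F x * χ x) x ^ 2 :=
    ((c1.continuous_deriv le_rfl).memLp_of_hasCompactSupport k1.deriv (p := 2)).integrable_sq
  have i4 : Integrable fun x => (F x * deriv χ x) ^ 2 := by
    have hs4 : tsupport (fun x => F x * deriv χ x) ⊆ tsupport χ :=
      closure_minimal (fun x hx => by
        by_contra h
        exact hx (by simp [deriv_eq_zero_of_notMem_tsupport h])) (isClosed_tsupport _)
    have hc4 : Continuous fun x => F x * deriv χ x := by
      refine contDiff_zero.1 (contDiff_of_contDiffAt_tsupport (n := 0) fun x hx => ?_)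
      exact ((hFat x (hχs (hs4 hx))).of_le zero_le_one).mul
        (contDiff_zero.2 (hχ.continuous_deriv le_rfl)).contDiffAt
    exact (hc4.memLp_of_hasCompactSupport (p := 2)
      (hχc.of_isClosed_subset (isClosed_tsupport _) hs4)).integrable_sq
  change _ = -∫ x, D x * deriv (fun x => F x * χ x ^ 2) x at ibp
  rw [integral_congr_ae p2, integral_neg, integral_add i1 i2] at ibp
  simp_rw [p1] at ibp
  rw [integral_sub i3 i4, integral_congr_ae p5] at ibp
  rw [integral_congr_ae p3, integral_congr_ae p4, integral_congr_ae p6] at sv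
  have e : ∫ x, potential p ω φ g x * u x ^ 2 * χ x ^ 2
      = (p - 2) * lagrange ω φ g * ∫ x, φ x ^ (p / 2 - 1) * u x ^ 2 * χ x ^ 2 := by
    rw [← integral_const_mul]
    refine integral_congr_ae (Eventually.of_forall fun x => ?_)
    simp only [potential]
    ring
  linarith

theorem tendsto_integral_mul_cutoff (H : BellMinimizer p ω φ g)
    (hL : Function.support φ = Ioo (-L) L) {w : ℝ → ℝ} (hw : Integrable w) (k : ℕ) (hk : k ≠ 0) :
    Tendsto (fun n => ∫ x, w x * cutoff φ n x ^ k) atTop (𝓝 (∫ x in Ioo (-L) L, w x)) := by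
  rw [← integral_indicator measurableSet_Ioo]
  refine tendsto_integral_of_dominated_convergence (fun x => |w x|) (fun n => ?_) hw.abs
    (fun n => Eventually.of_forall fun x => ?_) (Eventually.of_forall fun x => ?_)
  · exact hw.aestronglyMeasurable.mul
      ((H.contDiff_cutoff hL n).continuous.pow k).aestronglyMeasurable
  · rw [norm_mul, norm_pow, Real.norm_eq_abs, Real.norm_eq_abs, abs_of_nonneg (cutoff_nonneg _ _ _)]
    exact mul_le_of_le_one_right (abs_nonneg _)
      (pow_le_one₀ (cutoff_nonneg _ _ _) (cutoff_le_one _ _ _))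
  · by_cases hx : x ∈ Ioo (-L) L
    · rw [indicator_of_mem hx]
      simpa using ((tendsto_cutoff (hL ▸ hx : x ∈ Function.support φ)).pow k).const_mul (w x)
    · rw [indicator_of_notMem hx]
      refine tendsto_const_nhds.congr fun n => ?_
      rw [image_eq_zero_of_notMem_tsupport fun h => hx (H.tsupport_cutoff_subset hL n h),
        zero_pow hk, mul_zero]

/-- A weak solution of `𝓛₊ u = r` inside the support of `Φ` with `u` orthogonal to `Φ ^ (p - 1)`
satisfies `∫ r u ≥ 0`. -/
theorem setIntegral_mul_nonneg (H : BellMinimizer p ω φ g)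
    (hL : Function.support φ = Ioo (-L) L) (hL0 : 0 < L) (hΦ : ∀ x, Φ x = √(φ x))
    {u r : ℝ → ℝ} (hu : MemLp u 2) (hr : MemLp r 2)
    (heq : ∀ ψ : ℝ → ℝ, ContDiff ℝ (⊤ : ℕ∞) ψ → HasCompactSupport ψ → tsupport ψ ⊆ Ioo (-L) L →
      ∫ x, Φ x * u x * deriv (deriv ψ) x
        = ∫ x, -((r x + potential p ω φ g x * u x) / Φ x) * ψ x)
    (horth : ∫ x, Φ x ^ (p - 1) * u x = 0) :
    0 ≤ ∫ x in Ioo (-L) L, r x * u x := by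
  have h0 : (0 : ℝ) ∈ Ioo (-L) L := ⟨by linarith, hL0⟩
  have cΦ := H.continuous_sqrt hΦ
  have kΦ : HasCompactSupport Φ := by
    refine HasCompactSupport.of_support_subset_isCompact (isCompact_Icc (a := -L) (b := L))
      fun x hx => Ioo_subset_Icc_self ?_
    by_contra hn
    exact hx (sqrt_eq_zero hL hΦ hn)
  have lu : LocallyIntegrable u := hu.locallyIntegrable (by norm_num)
  have lr : LocallyIntegrable r := hr.locallyIntegrable (by norm_num)
  have iΦu : Integrable fun x => Φ x * u x :=
    (cΦ.memLp_of_hasCompactSupport (p := 2) kΦ).integrable_mul hu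
  have iΦu' : Integrable fun x => φ x ^ (p / 2 - 1) * (Φ x * u x) :=
    (((H.continuous_rpow_sub_one.mul cΦ).memLp_of_hasCompactSupport (p := 2)
      kΦ.mul_left).integrable_mul hu).congr (Eventually.of_forall fun x => by
        simp only [Pi.mul_apply]; ring)
  have hloc : LocallyIntegrableOn (fun x => -((r x + potential p ω φ g x * u x) / Φ x))
      (Ioo (-L) L) := by
    have l1 : LocallyIntegrableOn (fun x => r x + potential p ω φ g x * u x) (Ioo (-L) L) :=
      (lr.locallyIntegrableOn _).add ((lu.locallyIntegrableOn _).continuousOn_mul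
        H.continuous_potential.continuousOn isOpen_Ioo.isLocallyClosed)
    have l2 := l1.continuousOn_mul (g := fun x => -(Φ x)⁻¹)
      (cΦ.continuousOn.inv₀ fun x hx => (H.sqrt_pos hL hΦ hx).ne').neg
      isOpen_Ioo.isLocallyClosed
    refine l2.congr (Eventually.of_forall fun x => ?_)
    ring
  obtain ⟨F, d, hF, hDc, hD⟩ := exists_primitive_of_weak_second_deriv h0
    (iΦu.locallyIntegrable.locallyIntegrableOn _) hloc heq
  obtain ⟨K, hK⟩ := H.second_variation
  obtain ⟨C, hC⟩ := exists_bound_deriv_smoothTransition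
  have key := fun n => H.localized_form_ge hL hΦ hu hr hK hloc hF hDc hD (H.contDiff_cutoff hL n)
    (H.hasCompactSupport_cutoff hL n) (H.tsupport_cutoff_subset hL n)
  have t1 := H.tendsto_integral_mul_cutoff hL (hr.integrable_mul hu) 2 two_ne_zero
  have t2 := H.tendsto_integral_mul_cutoff hL iΦu 1 one_ne_zero
  have t3 := H.tendsto_integral_mul_cutoff hL iΦu' 1 one_ne_zero
  have t4 : Tendsto (fun n => ∫ x, (Φ x * u x * deriv (cutoff φ n) x) ^ 2) atTop (𝓝 0) := by
    have hb : ∀ n : ℕ, ∫ x, (Φ x * u x * deriv (cutoff φ n) x) ^ 2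
        ≤ (4 * ω * C ^ 2 * ∫ x, u x ^ 2) / ((n : ℝ) + 1) ^ 2 := by
      intro n
      have : (4 * ω * C ^ 2 * ∫ x, u x ^ 2) / ((n : ℝ) + 1) ^ 2
          = ∫ x, 4 * ω * C ^ 2 / ((n : ℝ) + 1) ^ 2 * u x ^ 2 := by
        rw [integral_const_mul]
        ring
      rw [this]
      refine integral_mono_of_nonneg (Eventually.of_forall fun x => sq_nonneg _)
        (hu.integrable_sq.const_mul _) (Eventually.of_forall fun x => ?_)
      have e : (Φ x * u x * deriv (cutoff φ n) x) ^ 2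
          = φ x * deriv (cutoff φ n) x ^ 2 * u x ^ 2 := by
        rw [← H.sqrt_sq hΦ x]
        ring
      simp only [e]
      refine mul_le_mul_of_nonneg_right ?_ (sq_nonneg _)
      by_cases hx : x ∈ Ioo (-L) L
      · exact H.mul_deriv_cutoff_sq_le hL hC n hx
      · rw [apply_eq_zero hL hx, zero_mul]
        have := H.ω_pos
        positivity
    refine squeeze_zero (fun n => integral_nonneg fun x => sq_nonneg _) hb ?_
    exact tendsto_const_nhds.div_atTop ((tendsto_pow_atTop two_ne_zero).comp
      (tendsto_atTop_add_const_right _ _ tendsto_natCast_atTop_atTop))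
  have hz : ∫ x in Ioo (-L) L, φ x ^ (p / 2 - 1) * (Φ x * u x) = 0 := by
    rw [← horth, ← integral_indicator measurableSet_Ioo]
    refine integral_congr_ae (Eventually.of_forall fun x => ?_)
    by_cases hx : x ∈ Ioo (-L) L
    · simp only [indicator_of_mem hx]
      rw [show p - 1 = (p - 2) + 1 by ring, Real.rpow_add_one (H.sqrt_pos hL hΦ hx).ne',
        H.sqrt_rpow_sub_two hΦ]
      ring
    · simp only [indicator_of_notMem hx]
      rw [sqrt_eq_zero hL hΦ hx, Real.zero_rpow (by linarith [H.two_lt]), zero_mul]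
  rw [hz] at t3
  simp only [pow_one] at t2 t3
  have lim := ((t1.add t4).add ((t3.pow 2).const_mul K)).add ((t3.const_mul (4 * ω)).mul t2)
  have := ge_of_tendsto lim (b := 0) (Eventually.of_forall fun n => by
    have := key n
    simp only [← mul_assoc] at this ⊢
    exact this)
  simpa using this

end BellMinimizer

/-! ### Self-adjoint extensions -/

section Abstract

variable {E : Type*} [NormedAddCommGroup E] [InnerProductSpace ℂ E]

theorem inner_map_eq_of_isSelfAdjoint [CompleteSpace E] {T : E →ₗ.[ℂ] E}
    (hT : IsSelfAdjoint T) (x y : T.domain) :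
    inner ℂ (T x) (y : E) = inner ℂ (x : E) (T y) := by
  have h := LinearPMap.adjoint_isFormalAdjoint hT.dense_domain
  rw [LinearPMap.isSelfAdjoint_def.1 hT] at h
  exact h x y

/-- A symmetric operator which is nonnegative on the orthogonal complement of a single vector has
at most one negative eigenvalue, counted with multiplicity. -/
theorem eigenvalue_unique_of_nonneg_on_orthogonal {T : E →ₗ.[ℂ] E} {e : E}
    (hsym : ∀ x y : T.domain, inner ℂ (T x) (y : E) = inner ℂ (x : E) (T y))
    (hpos : ∀ w : T.domain, inner ℂ e (w : E) = 0 → 0 ≤ (inner ℂ (w : E) (T w)).re)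
    {a b : ℝ} {u v : T.domain} (ha : a < 0) (hb : b < 0) (hu : u ≠ 0) (hv : v ≠ 0)
    (hTu : T u = (a : ℂ) • (u : E)) (hTv : T v = (b : ℂ) • (v : E)) :
    a = b ∧ ∃ k : ℂ, v = k • u := by
  have hneg : ∀ (c : ℝ) (w : T.domain), c < 0 → w ≠ 0 → T w = (c : ℂ) • (w : E) →
      (inner ℂ (w : E) (T w)).re < 0 := by
    intro c w hc hw hTw
    have hn : 0 < ‖(w : E)‖ := norm_pos_iff.2 fun h => hw (Subtype.ext h)
    have he : inner ℂ (w : E) (T w) = ((c * ‖(w : E)‖ ^ 2 : ℝ) : ℂ) := by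
      rw [hTw, inner_smul_right, inner_self_eq_norm_sq_to_K]
      push_cast
      rfl
    rw [he, Complex.ofReal_re]
    exact mul_neg_of_neg_of_pos hc (pow_pos hn 2)
  set α := inner ℂ e (u : E) with hα
  set β := inner ℂ e (v : E) with hβ
  have hα0 : α ≠ 0 := fun h => not_lt.2 (hpos u h) (hneg a u ha hu hTu)
  -- the combination of the two eigenvectors that is orthogonal to `e`
  set w : T.domain := β • u - α • v with hw
  have hwe : inner ℂ e (w : E) = 0 := by
    simp only [hw, Submodule.coe_sub, Submodule.coe_smul, inner_sub_right, inner_smul_right]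
    rw [← hα, ← hβ]
    ring
  have hTw : T w = (β * a) • (u : E) - (α * b) • (v : E) := by
    rw [hw, LinearPMap.map_sub, LinearPMap.map_smul, LinearPMap.map_smul, hTu, hTv, smul_smul,
      smul_smul]
  have hw0 := hpos w hwe
  by_cases hab : a = b
  · refine ⟨hab, β / α, ?_⟩
    have hwz : w = 0 := by
      by_contra h
      refine not_lt.2 hw0 (hneg a w ha h ?_)
      rw [hTw, ← hab, hw, Submodule.coe_sub, Submodule.coe_smul, Submodule.coe_smul, smul_sub,
        smul_smul, smul_smul, mul_comm β, mul_comm α]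
    have : α • v = β • u := (sub_eq_zero.1 (hw ▸ hwz)).symm
    rw [div_eq_inv_mul, ← smul_smul, ← this, smul_smul, inv_mul_cancel₀ hα0, one_smul]
  · exfalso
    have horth : inner ℂ (u : E) (v : E) = 0 := by
      have h := hsym u v
      rw [hTu, hTv, inner_smul_left, inner_smul_right, Complex.conj_ofReal] at h
      have : ((a : ℂ) - b) * inner ℂ (u : E) (v : E) = 0 := by linear_combination h
      refine (mul_eq_zero.1 this).resolve_left fun h0 => hab ?_
      exact_mod_cast sub_eq_zero.1 h0
    have horth' : inner ℂ (v : E) (u : E) = 0 := by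
      rw [← inner_conj_symm, horth, map_zero]
    have hn : 0 < ‖(v : E)‖ := norm_pos_iff.2 fun h => hv (Subtype.ext h)
    have key : inner ℂ (w : E) (T w)
        = ((a * (‖β‖ ^ 2 * ‖(u : E)‖ ^ 2) + b * (‖α‖ ^ 2 * ‖(v : E)‖ ^ 2) : ℝ) : ℂ) := by
      rw [hTw, hw]
      simp only [Submodule.coe_sub, Submodule.coe_smul, inner_sub_left, inner_sub_right,
        inner_smul_left, inner_smul_right, horth, horth', inner_self_eq_norm_sq_to_K]
      have e1 := Complex.conj_mul' β
      have e2 := Complex.conj_mul' α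
      push_cast
      linear_combination (a * (‖(u : E)‖ : ℂ) ^ 2) * e1 + (b * (‖(v : E)‖ : ℂ) ^ 2) * e2
    rw [key, Complex.ofReal_re] at hw0
    have h1 : a * (‖β‖ ^ 2 * ‖(u : E)‖ ^ 2) ≤ 0 :=
      mul_nonpos_of_nonpos_of_nonneg ha.le (by positivity)
    have h2 : b * (‖α‖ ^ 2 * ‖(v : E)‖ ^ 2) < 0 :=
      mul_neg_of_neg_of_pos hb (by have := norm_pos_iff.2 hα0; positivity)
    linarith

end Abstract

theorem contDiff_ofReal_comp {a : ℝ → ℝ} (ha : ContDiff ℝ (⊤ : ℕ∞) a) :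
    ContDiff ℝ (⊤ : ℕ∞) fun x => (a x : ℂ) :=
  Complex.ofRealCLM.contDiff.comp ha

theorem tsupport_ofReal_comp (a : ℝ → ℝ) : tsupport (fun x => (a x : ℂ)) = tsupport a := by
  unfold tsupport
  congr 1
  ext x
  simp

theorem isTest_ofReal_comp {a : ℝ → ℝ} (ha : ContDiff ℝ (⊤ : ℕ∞) a) (hc : HasCompactSupport a) :
    IsTest fun x => (a x : ℂ) :=
  ⟨contDiff_ofReal_comp ha, by unfold HasCompactSupport; rwa [tsupport_ofReal_comp]⟩

theorem deriv_ofReal_comp {a : ℝ → ℝ} (ha : Differentiable ℝ a) :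
    deriv (fun x => (a x : ℂ)) = fun x => ((deriv a x : ℝ) : ℂ) :=
  funext fun x => (ha x).hasDerivAt.ofReal_comp.deriv

/-- Real-linear functionals commute with integration against a real weight. -/
theorem integral_ofReal_mul_apply (ℓ : ℂ →L[ℝ] ℝ) {k : ℝ → ℝ} {u : ℝ → ℂ}
    (h : Integrable fun x => (k x : ℂ) * u x) :
    ∫ x, k x * ℓ (u x) = ℓ (∫ x, (k x : ℂ) * u x) := by
  rw [← ℓ.integral_comp_comm h]
  refine integral_congr_ae (Eventually.of_forall fun x => ?_)
  simp only
  rw [← Complex.real_smul, map_smul, smul_eq_mul]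

namespace BellMinimizer

variable {p ω L : ℝ} {φ g Φ : ℝ → ℝ} {T : L2 →ₗ.[ℂ] L2}

/-- Vectors in the domain of a self-adjoint extension of `𝓛₊` are weak solutions. -/
theorem integral_conj_Lplus_mul (hT : IsSelfAdjoint T)
    (hE : ExtendsLplus p ω L Φ T) (u : T.domain) {f : ℝ → ℂ} (hf : IsTest f)
    (h1 : L ∉ tsupport f) (h2 : -L ∉ tsupport f) :
    ∫ x, (starRingEnd ℂ) (Lplus p ω Φ f x) * ((u : L2) : ℝ → ℂ) x
      = ∫ x, (starRingEnd ℂ) (f x) * ((T u : L2) : ℝ → ℂ) x := by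
  obtain ⟨w, hw1, hw2⟩ := hE f hf h1 h2
  have h := inner_map_eq_of_isSelfAdjoint hT w u
  rw [L2.inner_def, L2.inner_def] at h
  have e1 : ∫ x, (starRingEnd ℂ) (Lplus p ω Φ f x) * ((u : L2) : ℝ → ℂ) x
      = ∫ x, inner ℂ (((T w : L2) : ℝ → ℂ) x) (((u : L2) : ℝ → ℂ) x) := by
    refine integral_congr_ae ?_
    filter_upwards [hw2] with x hx
    rw [hx, RCLike.inner_apply, mul_comm]
  have e2 : ∫ x, (starRingEnd ℂ) (f x) * ((T u : L2) : ℝ → ℂ) x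
      = ∫ x, inner ℂ (((w : L2) : ℝ → ℂ) x) (((T u : L2) : ℝ → ℂ) x) := by
    refine integral_congr_ae ?_
    filter_upwards [hw1] with x hx
    rw [hx, RCLike.inner_apply, mul_comm]
  rw [e1, e2, h]

theorem integrable_ofReal_mul_Lp {k : ℝ → ℝ} (hk : MemLp k 2) (u : L2) :
    Integrable fun x => (k x : ℂ) * (u : ℝ → ℂ) x :=
  hk.ofReal.integrable_mul (Lp.memLp u)

/-- Off the support of `Φ` the operator acts as multiplication by `ω`. -/
theorem ae_eq_of_notMem_Icc (H : BellMinimizer p ω φ g) (hL : Function.support φ = Ioo (-L) L)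
    (hL0 : 0 < L) (hΦ : ∀ x, Φ x = √(φ x)) (hT : IsSelfAdjoint T) (hE : ExtendsLplus p ω L Φ T)
    (u : T.domain) :
    ∀ᵐ x, x ∈ (Icc (-L) L)ᶜ → ((T u : L2) : ℝ → ℂ) x = ω * ((u : L2) : ℝ → ℂ) x := by
  have lu : LocallyIntegrable ((u : L2) : ℝ → ℂ) := (Lp.memLp _).locallyIntegrable (by norm_num)
  have lT : LocallyIntegrable ((T u : L2) : ℝ → ℂ) := (Lp.memLp _).locallyIntegrable (by norm_num)
  have key := (isClosed_Icc (a := -L) (b := L)).isOpen_compl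
    |>.ae_eq_zero_of_integral_contDiff_smul_eq_zero (μ := volume)
    (f := fun x => ((T u : L2) : ℝ → ℂ) x - (ω : ℂ) * ((u : L2) : ℝ → ℂ) x)
    ((lT.sub (lu.smul (ω : ℂ))).locallyIntegrableOn _) (by
      intro η e1 e2 e3
      have ht := isTest_ofReal_comp e1 e2
      have h := integral_conj_Lplus_mul hT hE u ht
        (by rw [tsupport_ofReal_comp]; exact fun h => e3 h ⟨by linarith, le_rfl⟩)
        (by rw [tsupport_ofReal_comp]; exact fun h => e3 h ⟨le_rfl, by linarith⟩)
      have hη : MemLp η 2 := e1.continuous.memLp_of_hasCompactSupport e2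
      have ea : ∫ x, (starRingEnd ℂ) (Lplus p ω Φ (fun x => (η x : ℂ)) x) * ((u : L2) : ℝ → ℂ) x
          = ∫ x, (ω : ℂ) * ((η x : ℂ) * ((u : L2) : ℝ → ℂ) x) := by
        refine integral_congr_ae ?_
        filter_upwards [H.Lplus_ae_eq hL hΦ ht] with x hx
        rw [hx]
        by_cases hx' : x ∈ Ioo (-L) L
        · have hn : x ∉ tsupport η := fun h => e3 h (Ioo_subset_Icc_self hx')
          rw [indicator_of_mem hx', indicator_of_notMem (by simpa using hx'),
            innerExpr_eq_zero (by rwa [tsupport_ofReal_comp]),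
            image_eq_zero_of_notMem_tsupport hn]
          simp
        · rw [indicator_of_notMem hx', indicator_of_mem (by simpa using hx')]
          simp
          ring
      have eb : ∫ x, (starRingEnd ℂ) (η x : ℂ) * ((T u : L2) : ℝ → ℂ) x
          = ∫ x, (η x : ℂ) * ((T u : L2) : ℝ → ℂ) x := by simp only [Complex.conj_ofReal]
      rw [ea, eb, integral_const_mul] at h
      have e : ∀ x, η x • (((T u : L2) : ℝ → ℂ) x - (ω : ℂ) * ((u : L2) : ℝ → ℂ) x)
          = (η x : ℂ) * ((T u : L2) : ℝ → ℂ) x - (ω : ℂ) * ((η x : ℂ) * ((u : L2) : ℝ → ℂ) x) :=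
        fun x => by rw [Complex.real_smul]; ring
      simp_rw [e]
      rw [integral_sub (integrable_ofReal_mul_Lp hη _)
        ((integrable_ofReal_mul_Lp hη _).const_mul _), integral_const_mul, h, sub_self])
  filter_upwards [key] with x hx hxm
  exact sub_eq_zero.1 (hx hxm)

/-- Inside the support of `Φ`, with `f = ψ / Φ` as test function, `𝓛₊` becomes the Schrödinger
operator `-G'' - (p - 2) c φ ^ (p / 2 - 2) G` acting on `G = Φ u`; `ℓ` serves for both the real and
the imaginary part. -/
theorem weak_equation (H : BellMinimizer p ω φ g) (hL : Function.support φ = Ioo (-L) L)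
    (hΦ : ∀ x, Φ x = √(φ x)) (hT : IsSelfAdjoint T) (hE : ExtendsLplus p ω L Φ T)
    (u : T.domain) (ℓ : ℂ →L[ℝ] ℝ) {ψ : ℝ → ℝ} (e1 : ContDiff ℝ (⊤ : ℕ∞) ψ)
    (e2 : HasCompactSupport ψ) (e3 : tsupport ψ ⊆ Ioo (-L) L) :
    ∫ x, Φ x * ℓ (((u : L2) : ℝ → ℂ) x) * deriv (deriv ψ) x
      = ∫ x, -((ℓ (((T u : L2) : ℝ → ℂ) x)
        + potential p ω φ g x * ℓ (((u : L2) : ℝ → ℂ) x)) / Φ x) * ψ x := by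
  set a : ℝ → ℝ := fun x => ψ x / Φ x with ha
  have hsub : tsupport a ⊆ tsupport ψ := closure_mono fun x hx hx' => hx (by simp [ha, hx'])
  have ha1 : ContDiff ℝ (⊤ : ℕ∞) a := contDiff_of_contDiffAt_tsupport fun x hx =>
    e1.contDiffAt.div ((H.contDiffOn_sqrt hL hΦ).contDiffAt (isOpen_Ioo.mem_nhds (e3 (hsub hx))))
      (H.sqrt_pos hL hΦ (e3 (hsub hx))).ne'
  have ha2 : HasCompactSupport a := e2.of_isClosed_subset (isClosed_tsupport _) hsub
  have ht := isTest_ofReal_comp ha1 ha2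
  have h := integral_conj_Lplus_mul hT hE u ht
    (by rw [tsupport_ofReal_comp]; exact fun h => lt_irrefl _ (e3 (hsub h)).2)
    (by rw [tsupport_ofReal_comp]; exact fun h => lt_irrefl _ (e3 (hsub h)).1)
  have hψ2 : Continuous (deriv (deriv ψ)) :=
    (contDiff_infty_iff_deriv.1 (contDiff_infty_iff_deriv.1 e1).2).2.continuous
  have c1 : Continuous fun x => Φ x * deriv (deriv ψ) x := (H.continuous_sqrt hΦ).mul hψ2
  have c2 : Continuous fun x => potential p ω φ g x * a x :=
    H.continuous_potential.mul ha1.continuous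
  have m1 : MemLp (fun x => Φ x * deriv (deriv ψ) x) 2 :=
    c1.memLp_of_hasCompactSupport e2.deriv.deriv.mul_left
  have m2 : MemLp (fun x => potential p ω φ g x * a x) 2 :=
    c2.memLp_of_hasCompactSupport ha2.mul_left
  have m4 : MemLp (fun x => -(Φ x * deriv (deriv ψ) x) - potential p ω φ g x * a x) 2 :=
    m1.neg.sub m2
  have m3 : MemLp a 2 := ha1.continuous.memLp_of_hasCompactSupport ha2
  have ma : (fun x => (Φ x : ℂ) * (a x : ℂ)) = fun x => (ψ x : ℂ) := by
    ext x
    by_cases hx : x ∈ Ioo (-L) L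
    · have := (H.sqrt_pos hL hΦ hx).ne'
      rw [← Complex.ofReal_mul]
      congr 1
      simp only [ha]
      field_simp
    · rw [sqrt_eq_zero hL hΦ hx, image_eq_zero_of_notMem_tsupport fun h => hx (e3 h)]
      simp
  have ea : ∫ x, (starRingEnd ℂ) (Lplus p ω Φ (fun x => (a x : ℂ)) x) * ((u : L2) : ℝ → ℂ) x
      = ∫ x, ((-(Φ x * deriv (deriv ψ) x) - potential p ω φ g x * a x : ℝ) : ℂ)
        * ((u : L2) : ℝ → ℂ) x := by
    refine integral_congr_ae ?_
    filter_upwards [ae_mem_Ioo_or_notMem_Icc (-L) L] with x hx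
    congr 1
    rcases hx with hx | hx
    · rw [H.Lplus_eq hL hΦ _ hx, ma, deriv_ofReal_comp (e1.differentiable (by simp)),
        deriv_ofReal_comp ((contDiff_infty_iff_deriv.1 e1).2.differentiable (by simp))]
      simp only [potential, map_sub, map_neg, map_mul, Complex.conj_ofReal]
      push_cast
      ring
    · have hn : x ∉ Ioo (-L) L := fun h => hx (Ioo_subset_Icc_self h)
      rw [H.Lplus_eq_of_notMem hL hΦ _ hx, sqrt_eq_zero hL hΦ hn]
      have : a x = 0 := by simp [ha, sqrt_eq_zero hL hΦ hn]
      simp [this]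
  have eb : ∫ x, (starRingEnd ℂ) (a x : ℂ) * ((T u : L2) : ℝ → ℂ) x
      = ∫ x, (a x : ℂ) * ((T u : L2) : ℝ → ℂ) x := by simp only [Complex.conj_ofReal]
  rw [ea, eb] at h
  have h' := congrArg ℓ h
  rw [← integral_ofReal_mul_apply ℓ (integrable_ofReal_mul_Lp m4 _),
    ← integral_ofReal_mul_apply ℓ (integrable_ofReal_mul_Lp m3 _)] at h'
  have mu : MemLp (fun x => ℓ (((u : L2) : ℝ → ℂ) x)) 2 := ℓ.comp_memLp' (Lp.memLp _)
  have mT : MemLp (fun x => ℓ (((T u : L2) : ℝ → ℂ) x)) 2 := ℓ.comp_memLp' (Lp.memLp _)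
  have i1 : Integrable fun x => Φ x * deriv (deriv ψ) x * ℓ (((u : L2) : ℝ → ℂ) x) :=
    m1.integrable_mul mu
  have i2 : Integrable fun x => potential p ω φ g x * a x * ℓ (((u : L2) : ℝ → ℂ) x) :=
    m2.integrable_mul mu
  have i3 : Integrable fun x => a x * ℓ (((T u : L2) : ℝ → ℂ) x) := m3.integrable_mul mT
  have s1 : ∀ x, (-(Φ x * deriv (deriv ψ) x) - potential p ω φ g x * a x)
      * ℓ (((u : L2) : ℝ → ℂ) x) = -(Φ x * deriv (deriv ψ) x * ℓ (((u : L2) : ℝ → ℂ) x))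
      - potential p ω φ g x * a x * ℓ (((u : L2) : ℝ → ℂ) x) := fun x => by ring
  simp_rw [s1] at h'
  rw [integral_sub i1.fun_neg i2, integral_neg] at h'
  have s2 : ∀ x, Φ x * ℓ (((u : L2) : ℝ → ℂ) x) * deriv (deriv ψ) x
      = Φ x * deriv (deriv ψ) x * ℓ (((u : L2) : ℝ → ℂ) x) := fun x => by ring
  have s3 : ∀ x, -((ℓ (((T u : L2) : ℝ → ℂ) x)
        + potential p ω φ g x * ℓ (((u : L2) : ℝ → ℂ) x)) / Φ x) * ψ x
      = -(a x * ℓ (((T u : L2) : ℝ → ℂ) x))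
        - potential p ω φ g x * a x * ℓ (((u : L2) : ℝ → ℂ) x) := fun x => by
    simp only [ha]
    ring
  simp_rw [s2, s3]
  rw [integral_sub i3.fun_neg i2, integral_neg]
  linarith

theorem memLp_sqrt_rpow (H : BellMinimizer p ω φ g) (hL : Function.support φ = Ioo (-L) L)
    (hΦ : ∀ x, Φ x = √(φ x)) : MemLp (fun x => Φ x ^ (p - 1)) 2 := by
  have hp := H.two_lt
  refine Continuous.memLp_of_hasCompactSupport
    ((H.continuous_sqrt hΦ).rpow_const fun _ => Or.inr (by linarith)) ?_
  refine HasCompactSupport.of_support_subset_isCompact (isCompact_Icc (a := -L) (b := L))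
    fun x hx => Ioo_subset_Icc_self ?_
  by_contra hn
  exact hx (by simp [sqrt_eq_zero hL hΦ hn, Real.zero_rpow (show p - 1 ≠ 0 by linarith)])

/-- The quadratic form of a self-adjoint extension of `𝓛₊` is nonnegative on the orthogonal
complement of `Φ ^ (p - 1)`. As `Φ` is real, the real and imaginary parts are treated separately. -/
theorem re_inner_nonneg (H : BellMinimizer p ω φ g) (hL : Function.support φ = Ioo (-L) L)
    (hL0 : 0 < L) (hΦ : ∀ x, Φ x = √(φ x)) (hT : IsSelfAdjoint T) (hE : ExtendsLplus p ω L Φ T)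
    (u : T.domain) (horth : ∫ x, ((Φ x ^ (p - 1) : ℝ) : ℂ) * ((u : L2) : ℝ → ℂ) x = 0) :
    0 ≤ (inner ℂ (u : L2) (T u)).re := by
  have mu : ∀ ℓ : ℂ →L[ℝ] ℝ, MemLp (fun x => ℓ (((u : L2) : ℝ → ℂ) x)) 2 := fun ℓ =>
    ℓ.comp_memLp' (Lp.memLp _)
  have mT : ∀ ℓ : ℂ →L[ℝ] ℝ, MemLp (fun x => ℓ (((T u : L2) : ℝ → ℂ) x)) 2 := fun ℓ =>
    ℓ.comp_memLp' (Lp.memLp _)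
  have hi : ∀ ℓ : ℂ →L[ℝ] ℝ, Integrable fun x =>
      ℓ (((T u : L2) : ℝ → ℂ) x) * ℓ (((u : L2) : ℝ → ℂ) x) := fun ℓ =>
    (mT ℓ).integrable_mul (mu ℓ)
  have key : ∀ ℓ : ℂ →L[ℝ] ℝ,
      0 ≤ ∫ x, ℓ (((T u : L2) : ℝ → ℂ) x) * ℓ (((u : L2) : ℝ → ℂ) x) := by
    intro ℓ
    rw [← integral_add_compl (measurableSet_Ioo (a := -L) (b := L)) (hi ℓ)]
    refine add_nonneg ?_ ?_
    · refine H.setIntegral_mul_nonneg hL hL0 hΦ (mu ℓ) (mT ℓ)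
        (fun ψ e1 e2 e3 => H.weak_equation hL hΦ hT hE u ℓ e1 e2 e3) ?_
      rw [integral_ofReal_mul_apply ℓ (integrable_ofReal_mul_Lp (H.memLp_sqrt_rpow hL hΦ) _),
        horth, map_zero]
    · refine setIntegral_nonneg_of_ae_restrict ?_
      rw [EventuallyLE, ae_restrict_iff' measurableSet_Ioo.compl]
      filter_upwards [H.ae_eq_of_notMem_Icc hL hL0 hΦ hT hE u,
        ae_mem_Ioo_or_notMem_Icc (-L) L] with x hx hx' hxm
      rw [hx (hx'.resolve_left hxm), ← Complex.real_smul, map_smul, smul_eq_mul, mul_assoc]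
      exact mul_nonneg H.ω_pos.le (mul_self_nonneg _)
  have h1 := key Complex.reCLM
  have h2 := key Complex.imCLM
  have h3 : (inner ℂ (u : L2) (T u)).re
      = (∫ x, Complex.reCLM (((T u : L2) : ℝ → ℂ) x) * Complex.reCLM (((u : L2) : ℝ → ℂ) x))
      + ∫ x, Complex.imCLM (((T u : L2) : ℝ → ℂ) x) * Complex.imCLM (((u : L2) : ℝ → ℂ) x) := by
    rw [L2.inner_def, ← integral_add (hi _) (hi _), ← Complex.reCLM_apply,
      ← Complex.reCLM.integral_comp_comm (L2.integrable_inner _ _)]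
    refine integral_congr_ae (Eventually.of_forall fun x => ?_)
    simp [RCLike.inner_apply]
  rw [h3]
  exact add_nonneg h1 h2

end BellMinimizer

end Compacton

theorem proposition4 (p ω : ℝ) (hp : 2 < p) (hω : 0 < ω) (φ Φ : ℝ → ℝ)
    (hcont : Continuous φ) (hbell : Compacton.BellShaped φ)
    (hmin : Compacton.IsMinimizerV p ω φ) (hΦ : ∀ x, Φ x = √(φ x)) :
    Compacton.BellShaped Φ ∧ Compacton.IsMinimizerU p ω Φ ∧
    ∃ L : ℝ, 0 < L ∧ Function.support Φ = Ioo (-L) L ∧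
      -- the Euler–Lagrange equation on `(-L, L)`
      ContDiffOn ℝ 2 Φ (Ioo (-L) L) ∧
      (∀ x ∈ Ioo (-L) L,
        -Φ x * deriv (fun y => Φ y * deriv Φ y) x + ω * Φ x
          - Compacton.multiplier ω Φ * Φ x ^ (p - 1) = 0) ∧
      -- `𝓛₊` maps test functions to `L²` and is symmetric
      (∀ f : ℝ → ℂ, Compacton.IsTest f → MemLp (Compacton.Lplus p ω Φ f) 2) ∧
      (∀ f h : ℝ → ℂ, Compacton.IsTest f → Compacton.IsTest h →
        ∫ x, Compacton.Lplus p ω Φ f x * (starRingEnd ℂ) (h x)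
          = ∫ x, f x * (starRingEnd ℂ) (Compacton.Lplus p ω Φ h x)) ∧
      -- every self-adjoint extension
      ∀ T : Compacton.L2 →ₗ.[ℂ] Compacton.L2, IsSelfAdjoint T →
        Compacton.ExtendsLplus p ω L Φ T →
        -- is nonnegative on the orthogonal complement of `Φ ^ (p - 1)`
        (∀ u : T.domain,
          ∫ x, ((Φ x ^ (p - 1) : ℝ) : ℂ) * ((u : Compacton.L2) : ℝ → ℂ) x = 0 →
            0 ≤ (inner ℂ (u : Compacton.L2) (T u)).re) ∧
        -- and has at most one negative eigenvalue, counted with multiplicity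
        (∀ (a b : ℝ) (u v : T.domain), a < 0 → b < 0 → u ≠ 0 → v ≠ 0 →
          T u = (a : ℂ) • (u : Compacton.L2) → T v = (b : ℂ) • (v : Compacton.L2) →
            a = b ∧ ∃ k : ℂ, v = k • u) := by
  obtain ⟨g, hadm, hmin⟩ := hmin
  have H : Compacton.BellMinimizer p ω φ g := ⟨hp, hω, hcont, hbell, hadm, hmin⟩
  obtain ⟨L, hL0, hL⟩ := H.exists_support_eq
  have hsupp : Function.support Φ = Ioo (-L) L := by
    rw [← hL]
    ext x
    rw [Function.mem_support, Function.mem_support, hΦ, Ne, Real.sqrt_eq_zero (H.nonneg x)]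
  refine ⟨H.bellShaped_sqrt hΦ, H.isMinimizerU_sqrt hΦ, L, hL0, hsupp,
    by exact_mod_cast contDiffOn_infty.1 (H.contDiffOn_sqrt hL hΦ) 2,
    fun x hx => H.euler_lagrange_sqrt hL hΦ hx, fun f hf => H.memLp_Lplus hL hΦ hf,
    fun f h hf hh => H.symmetric_Lplus hL hL0 hΦ hf hh, fun T hT hE =>
    ⟨fun u hu => H.re_inner_nonneg hL hL0 hΦ hT hE u hu, fun a b u v ha hb hu hv hTu hTv => ?_⟩⟩
  have hm : MemLp (fun x => ((Φ x ^ (p - 1) : ℝ) : ℂ)) 2 := (H.memLp_sqrt_rpow hL hΦ).ofReal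
  refine Compacton.eigenvalue_unique_of_nonneg_on_orthogonal (e := hm.toLp _)
    (Compacton.inner_map_eq_of_isSelfAdjoint hT) (fun w hw => ?_) ha hb hu hv hTu hTv
  refine H.re_inner_nonneg hL hL0 hΦ hT hE w ?_
  rw [← hw, L2.inner_def]
  refine integral_congr_ae ?_
  filter_upwards [hm.coeFn_toLp] with x hx
  rw [hx, RCLike.inner_apply, Complex.conj_ofReal, mul_comm]
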